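/- **Setting.** Let $L,K,N$ be natural numbers and let $F$ be the $L\times L$ normalized DFT matrix, $F(\omega,\ell)=L^{-1/2}e^{-2\pi i(\omega-1)(\ell-1)/L}$. Let $B$ be a deterministic real $L\times K$ matrix with orthonormal columns ($B^*B=I$), and let $C$ be a random real $L\times N$ matrix whose entries are independent $\mathrm{Normal}(0,1/L)$ random variables. Put $\hat B=FB$ and $\hat C=FC$, let $\hat b_\ell\in\mathbb C^K$ be the $\ell$-th column of $\hat B^*$ and $\hat c_\ell\in\mathbb C^N$ the $\ell$-th row of $\sqrt L\,\hat C$, and let $A_\ell=\hat b_\ell\hat c_\ell^*$. Let $\mathcal A$ be the linear operator from $K\times N$ matrices (with the Frobenius inner product) to $\mathbb C^L$ given by $(\mathcal A(X))(\ell)=\operatorname{Tr}(A_\ell^*X)$, let $\mathcal A^*$ be its adjoint, and set $$\mu_{\max}^2=\frac LK\max_{1\le\ell\le L}\|\hat b_\ell\|_2^2,\qquad \mu_{\min}^2=\frac LK\min_{1\le\ell\le L}\|\hat b_\ell\|_2^2 .$$ **Lemma ($\mathcal A\mathcal A^*$ is well conditioned).** There is an absolute constant $c>0$, and for every $\alpha\ge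 1$ there is a constant $C_\alpha>1$ depending only on $\alpha$, such that the following holds for all $L,K,N$ and $B$ as above with $\mu_{\min}^2>0$. If $$NK\ \ge\ \frac{C_\alpha}{\mu_{\min}^2}\,L\log^2L,$$ then with probability exceeding $1-c\,L^{-\alpha+1}$ all eigenvalues of $\mathcal A\mathcal A^*$ (which are real) lie in the interval $$\Big[\,0.48\,\mu_{\min}^2\frac{NK}{L},\ \ 4.5\,\mu_{\max}^2\frac{NK}{L}\,\Big].$$ -/

import Mathlib

open MeasureTheory ProbabilityTheory
open scoped Matrix NNReal

noncomputable section

namespace BlindDeconv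

/-- The `L`-point normalized discrete Fourier transform matrix (indices start at `0`). -/
def dftMatrix (L : ℕ) : Matrix (Fin L) (Fin L) ℂ :=
  Matrix.of fun w l =>
    (1 / (Real.sqrt L : ℂ)) *
      Complex.exp (-Complex.I * (2 * Real.pi) * ((w : ℕ) : ℂ) * ((l : ℕ) : ℂ) / (L : ℂ))

/-- The matrix `M̂ = F M` of a real matrix `M` with `L` rows. -/
def hat {L J : ℕ} (M : Matrix (Fin L) (Fin J) ℝ) : Matrix (Fin L) (Fin J) ℂ :=
  dftMatrix L * M.map (fun x : ℝ => (x : ℂ))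

/-- `b̂_l`: the `l`-th column of `B̂ᴴ`. -/
def bHat {L K : ℕ} (B : Matrix (Fin L) (Fin K) ℝ) (l : Fin L) : EuclideanSpace ℂ (Fin K) :=
  WithLp.toLp 2 fun k => (hat B)ᴴ k l

/-- `ĉ_l`: the `l`-th row of `√L Ĉ`. -/
def cHat {L N : ℕ} (C : Matrix (Fin L) (Fin N) ℝ) (l : Fin L) : EuclideanSpace ℂ (Fin N) :=
  WithLp.toLp 2 fun n => (Real.sqrt L : ℂ) * hat C l n

/-- The coherence `μ_max² = (L / K) max_l ‖b̂_l‖²`. -/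
def muMaxSq {L K : ℕ} (B : Matrix (Fin L) (Fin K) ℝ) : ℝ :=
  (L : ℝ) / (K : ℝ) * ⨆ l : Fin L, ‖bHat B l‖ ^ 2

/-- The coherence `μ_min² = (L / K) min_l ‖b̂_l‖²`. -/
def muMinSq {L K : ℕ} (B : Matrix (Fin L) (Fin K) ℝ) : ℝ :=
  (L : ℝ) / (K : ℝ) * ⨅ l : Fin L, ‖bHat B l‖ ^ 2

/-- The `K × N` measurement matrix `A_l = b̂_l ĉ_lᴴ`. -/
def measMatrix {L K N : ℕ} (B : Matrix (Fin L) (Fin K) ℝ) (C : Matrix (Fin L) (Fin N) ℝ)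
    (l : Fin L) : Matrix (Fin K) (Fin N) ℂ :=
  Matrix.vecMulVec (fun k => bHat B l k) (fun n => star (cHat C l n))

/-- The linear operator `𝒜` on `K × N` matrices, `(𝒜 X)(l) = Tr (A_lᴴ X)`. The space of
`K × N` matrices with the Frobenius inner product is `EuclideanSpace ℂ (Fin K × Fin N)`. -/
def measOp {L K N : ℕ} (B : Matrix (Fin L) (Fin K) ℝ) (C : Matrix (Fin L) (Fin N) ℝ) :
    EuclideanSpace ℂ (Fin K × Fin N) →ₗ[ℂ] EuclideanSpace ℂ (Fin L) where
  toFun X := WithLp.toLp 2 fun l =>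
    ((measMatrix B C l)ᴴ * Matrix.of fun k n => X (k, n)).trace
  map_add' X Y := by
    ext l
    simp [Matrix.trace, Matrix.mul_apply, mul_add, Finset.sum_add_distrib]
  map_smul' a X := by
    ext l
    simp [Matrix.trace, Matrix.mul_apply, Finset.mul_sum, mul_left_comm]

/-- The operator `𝒜𝒜*` on `ℂ^L`. -/
def measOpGram {L K N : ℕ} (B : Matrix (Fin L) (Fin K) ℝ) (C : Matrix (Fin L) (Fin N) ℝ) :
    Module.End ℂ (EuclideanSpace ℂ (Fin L)) :=
  measOp B C ∘ₗ LinearMap.adjoint (measOp B C)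

end BlindDeconv

end

/-! ### The Lie product formula. -/

section LieTrotter

open Filter Topology

/-! In coordinates `𝒜𝒜*` is a sum of `N` independent copies of the positive semidefinite matrix `Z =
D B̂ B̂ᴴ Dᴴ`, where `D` is the diagonal matrix of the Fourier transform `c` of one Gaussian column.
Since `c` is isotropic, `Z` has mean `diag ‖b̂_l‖²`, so the spectrum should lie near `[N min
‖b̂_l‖², N max ‖b̂_l‖²]`. The proof is a matrix Chernoff bound. Golden-Thompson
(`Matrix.re_trace_exp_add_le`) peels the summands off `E Tr exp(s ∑ Z_i)` one at a time
(`Matrix.lintegral_re_trace_exp_sum_le`), and Markov's inequality finishes.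

The difficulty is that `Z` is unbounded. As `B̂ B̂ᴴ` is a projection, `Z ≤ ‖c‖_∞²`, whence `exp(sZ)
≤ 1 + s exp(s‖c‖_∞²) Z` for either sign of `s`. It remains to compare the tilted moments `E
exp(s‖c‖_∞²) |⟨y, c⟩|²` with `‖y‖²`. For `s = ±p/16` the loss is a factor `(32 L²)^p`
(`integral_exp_mul_norm_sq_bounds`), which is at most `1.3` when `p` is a small multiple of `1 / log
L`. With `|s|` of order `1 / log L`, the Chernoff exponent `|s| N min ‖b̂_l‖²` beats `α log L` once
`N min ‖b̂_l‖²` is at least a multiple of `α log² L`; this is the source of the squared logarithm.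
-/

theorem norm_pow_sub_pow_le {𝔸 : Type*} [NormedRing 𝔸] [NormOneClass 𝔸] {x y : 𝔸} {M : ℝ}
    (hx : ‖x‖ ≤ M) (hy : ‖y‖ ≤ M) (m : ℕ) :
    ‖x ^ (m + 1) - y ^ (m + 1)‖ ≤ (m + 1) * M ^ m * ‖x - y‖ := by
  have hM : 0 ≤ M := (norm_nonneg x).trans hx
  induction m with
  | zero => simp
  | succ m ih =>
    have h1 : x ^ (m + 1 + 1) - y ^ (m + 1 + 1)
        = x ^ (m + 1) * (x - y) + (x ^ (m + 1) - y ^ (m + 1)) * y := by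
      rw [pow_succ x (m + 1), pow_succ y (m + 1)]; noncomm_ring
    rw [h1]
    have h2 : ‖x ^ (m + 1)‖ ≤ M ^ (m + 1) :=
      (norm_pow_le x _).trans (pow_le_pow_left₀ (norm_nonneg _) hx _)
    calc _ ≤ ‖x ^ (m + 1)‖ * ‖x - y‖ + ‖x ^ (m + 1) - y ^ (m + 1)‖ * ‖y‖ :=
          (norm_add_le _ _).trans (add_le_add (norm_mul_le _ _) (norm_mul_le _ _))
      _ ≤ M ^ (m + 1) * ‖x - y‖ + ((m + 1) * M ^ m * ‖x - y‖) * M := by gcongr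
      _ = _ := by push_cast; ring

theorem norm_exp_le_exp_norm {𝔸 : Type*} [NormedRing 𝔸] [NormOneClass 𝔸] [NormedAlgebra ℝ 𝔸]
    [CompleteSpace 𝔸] (x : 𝔸) : ‖NormedSpace.exp x‖ ≤ Real.exp ‖x‖ := by
  rw [NormedSpace.exp_eq_tsum ℝ, Real.exp_eq_exp_ℝ, NormedSpace.exp_eq_tsum ℝ]
  have hs : Summable fun n : ℕ => ((n.factorial : ℝ)⁻¹) • ‖x‖ ^ n :=
    NormedSpace.expSeries_summable' (𝕂 := ℝ) ‖x‖
  refine tsum_of_norm_bounded hs.hasSum fun n => ?_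
  rw [norm_smul, smul_eq_mul, norm_inv, RCLike.norm_natCast]
  gcongr
  exact norm_pow_le x n

/-- The Lie product formula. -/
theorem tendsto_exp_mul_exp_pow {𝔸 : Type*} [NormedRing 𝔸] [NormOneClass 𝔸] [NormedAlgebra ℝ 𝔸]
    [CompleteSpace 𝔸] (a b : 𝔸) :
    Tendsto (fun m : ℕ => (NormedSpace.exp ((m + 1 : ℝ)⁻¹ • a) *
      NormedSpace.exp ((m + 1 : ℝ)⁻¹ • b)) ^ (m + 1)) atTop (𝓝 (NormedSpace.exp (a + b))) := by
  let : NormedAlgebra ℚ 𝔸 := NormedAlgebra.restrictScalars ℚ ℝ 𝔸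
  -- The two one-step factors agree to first order at `0`, so their difference is `o(1/m)`; raising
  -- to the power `m + 1` multiplies it by at most a constant times `m + 1`.
  have hd : HasDerivAt (fun t : ℝ => NormedSpace.exp (t • a) * NormedSpace.exp (t • b)
      - NormedSpace.exp (t • (a + b))) 0 0 := by
    have h1 := (hasDerivAt_exp_smul_const (𝕂 := ℝ) a 0).mul (hasDerivAt_exp_smul_const (𝕂 := ℝ) b 0)
    have h2 := h1.sub (hasDerivAt_exp_smul_const (𝕂 := ℝ) (a + b) 0)
    refine h2.congr_deriv ?_
    simp
  have hslope := hd.tendsto_slope_zero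
  have hseq : Tendsto (fun m : ℕ => ((m : ℝ) + 1)⁻¹) atTop (𝓝[≠] 0) := by
    refine tendsto_nhdsWithin_iff.2 ⟨?_, ?_⟩
    · simpa [one_div] using tendsto_one_div_add_atTop_nhds_zero_nat (𝕜 := ℝ)
    · exact Eventually.of_forall fun m => by
        simp only [Set.mem_compl_iff, Set.mem_singleton_iff]; positivity
  have h3 := (hslope.comp hseq).norm
  simp only [Function.comp_def, zero_add, zero_smul, NormedSpace.exp_zero, mul_one, sub_self,
    sub_zero, inv_inv, norm_zero, norm_smul] at h3
  have h4 := h3.const_mul (Real.exp (‖a‖ + ‖b‖))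
  rw [mul_zero] at h4
  rw [tendsto_iff_norm_sub_tendsto_zero]
  refine squeeze_zero (fun _ => norm_nonneg _) (fun m => ?_) h4
  set s : ℝ := ((m : ℝ) + 1)⁻¹ with hs
  have hs0 : 0 ≤ s := by positivity
  have hexp : NormedSpace.exp (a + b) = NormedSpace.exp (s • (a + b)) ^ (m + 1) := by
    rw [← NormedSpace.exp_nsmul, ← Nat.cast_smul_eq_nsmul ℝ, smul_smul, hs]
    push_cast
    rw [mul_inv_cancel₀ (by positivity), one_smul]
  have hn : ∀ z : 𝔸, ‖s • z‖ = s * ‖z‖ := fun z => by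
    rw [norm_smul, Real.norm_of_nonneg hs0]
  have hx : ‖NormedSpace.exp (s • a) * NormedSpace.exp (s • b)‖ ≤ Real.exp (s * (‖a‖ + ‖b‖)) := by
    rw [mul_add, Real.exp_add]
    refine (norm_mul_le _ _).trans ?_
    gcongr
    · exact (norm_exp_le_exp_norm _).trans_eq (by rw [hn])
    · exact (norm_exp_le_exp_norm _).trans_eq (by rw [hn])
  have hy : ‖NormedSpace.exp (s • (a + b))‖ ≤ Real.exp (s * (‖a‖ + ‖b‖)) := by
    refine (norm_exp_le_exp_norm _).trans (Real.exp_le_exp.2 ?_)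
    rw [hn]
    gcongr
    exact norm_add_le _ _
  rw [hexp]
  refine (norm_pow_sub_pow_le hx hy m).trans ?_
  have h5 : Real.exp (s * (‖a‖ + ‖b‖)) ^ m ≤ Real.exp (‖a‖ + ‖b‖) := by
    rw [← Real.exp_nat_mul]
    refine Real.exp_le_exp.2 ?_
    rw [← mul_assoc]
    refine mul_le_of_le_one_left (by positivity) ?_
    rw [hs, ← div_eq_mul_inv, div_le_one (by positivity)]
    linarith
  calc _ ≤ ((m : ℝ) + 1) * Real.exp (‖a‖ + ‖b‖) *
        ‖NormedSpace.exp (s • a) * NormedSpace.exp (s • b) - NormedSpace.exp (s • (a + b))‖ := by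
        gcongr
    _ = _ := by
        rw [Real.norm_of_nonneg (by positivity)]; ring

end LieTrotter

/-! ### Trace inequalities and Golden-Thompson. -/

section GoldenThompson

open scoped ComplexOrder

namespace Matrix

variable {n : Type*} [Fintype n]

theorem re_trace_conjTranspose_mul_self_nonneg {m : Type*} [Fintype m] (X : Matrix m n ℂ) :
    0 ≤ (Xᴴ * X).trace.re :=
  (Complex.le_def.1 (posSemidef_conjTranspose_mul_self X).trace_nonneg).1

theorem re_trace_mul_self_le (X : Matrix n n ℂ) : (X * X).trace.re ≤ (Xᴴ * X).trace.re := by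
  have h := re_trace_conjTranspose_mul_self_nonneg (X - Xᴴ)
  have h1 : (Xᴴ * Xᴴ).trace.re = (X * X).trace.re := by
    rw [← conjTranspose_mul, trace_conjTranspose]; simp
  simp only [conjTranspose_sub, conjTranspose_conjTranspose, sub_mul, mul_sub, trace_sub,
    Complex.sub_re, h1] at h
  rw [trace_mul_comm X Xᴴ] at h
  linarith

theorem re_trace_mul_le_of_isHermitian {P Q : Matrix n n ℂ} (hP : P.IsHermitian)
    (hQ : Q.IsHermitian) : 2 * (P * Q).trace.re ≤ (P * P).trace.re + (Q * Q).trace.re := by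
  have h := re_trace_conjTranspose_mul_self_nonneg (P - Q)
  simp only [conjTranspose_sub, hP.eq, hQ.eq, sub_mul, mul_sub, trace_sub,
    Complex.sub_re] at h
  rw [trace_mul_comm Q P] at h
  linarith

variable [DecidableEq n]

theorem trace_pow_mul_comm (A B : Matrix n n ℂ) (k : ℕ) :
    ((A * B) ^ k).trace = ((B * A) ^ k).trace := by
  cases k with
  | zero => simp
  | succ k =>
    have h : (A * B) ^ k * A = A * (B * A) ^ k := by
      have : SemiconjBy A (B * A) (A * B) := by simp [SemiconjBy, mul_assoc]
      exact (this.pow_right k).eq.symm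
    rw [pow_succ, ← mul_assoc, h, trace_mul_comm, ← mul_assoc, ← pow_succ']

/-- The two claims feed each other. Squaring `X` and cycling the trace reduces the first to the
second for the Hermitian pair `XᴴX`, `XXᴴ`, followed by `2 Tr PQ ≤ Tr P² + Tr Q²`. The second
follows from the first for `X = AB` and from its own previous case for `A²`, `B²`. -/
theorem re_trace_pow_two_pow_le (k : ℕ) :
    (∀ X : Matrix n n ℂ, (X ^ 2 ^ (k + 1)).trace.re ≤ ((Xᴴ * X) ^ 2 ^ k).trace.re) ∧
    ∀ A B : Matrix n n ℂ, A.IsHermitian → B.IsHermitian →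
      ((A * B) ^ 2 ^ k).trace.re ≤ (A ^ 2 ^ k * B ^ 2 ^ k).trace.re := by
  induction k with
  | zero => exact ⟨fun X => by simpa [pow_two] using re_trace_mul_self_le X, by simp⟩
  | succ k ih =>
    obtain ⟨hN, hT⟩ := ih
    constructor
    · intro X
      have e1 : X ^ 2 ^ (k + 1 + 1) = (X * X) ^ 2 ^ (k + 1) := by
        rw [← pow_two, ← pow_mul, ← pow_succ']
      have e2 : (X * X)ᴴ * (X * X) = Xᴴ * (Xᴴ * X * X) := by
        rw [conjTranspose_mul]; simp only [mul_assoc]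
      have hX : (Xᴴ * X).IsHermitian := isHermitian_conjTranspose_mul_self X
      have hX' : (X * Xᴴ).IsHermitian := isHermitian_mul_conjTranspose_self X
      have h1 := hN (X * X)
      rw [← e1, e2, trace_pow_mul_comm, mul_assoc (Xᴴ * X)] at h1
      have h2 := hT _ _ hX hX'
      have h3 := re_trace_mul_le_of_isHermitian (hX.pow (2 ^ k)) (hX'.pow (2 ^ k))
      rw [← pow_two, ← pow_two, ← pow_mul, ← pow_mul, ← pow_succ,
        trace_pow_mul_comm X Xᴴ] at h3
      linarith
    · intro A B hA hB
      have h1 := hN (A * B)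
      have e : (A * B)ᴴ * (A * B) = B * (A ^ 2 * B) := by
        rw [conjTranspose_mul, hA.eq, hB.eq, pow_two]; simp only [mul_assoc]
      rw [e, trace_pow_mul_comm B, mul_assoc, ← pow_two B] at h1
      have h2 := hT _ _ (hA.pow 2) (hB.pow 2)
      rw [← pow_mul, ← pow_mul, ← pow_succ'] at h2
      exact h1.trans h2

open Filter Topology in
/-- The Golden-Thompson inequality. -/
theorem re_trace_exp_add_le {A B : Matrix n n ℂ} (hA : A.IsHermitian) (hB : B.IsHermitian) :
    (NormedSpace.exp (A + B)).trace.re ≤ (NormedSpace.exp A * NormedSpace.exp B).trace.re := by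
  rcases isEmpty_or_nonempty n with hn | hn
  · simp [trace]
  open scoped Norms.Operator in
  have hlim := tendsto_exp_mul_exp_pow A B
  -- The trace inequality is available only for exponents `2 ^ k`, so the Lie limit is taken along
  -- `m + 1 = 2 ^ k`.
  have hsub : Tendsto (fun k : ℕ => 2 ^ k - 1) atTop atTop :=
    (tendsto_sub_atTop_nat 1).comp (tendsto_pow_atTop_atTop_of_one_lt one_lt_two)
  have hcont : Continuous fun X : Matrix n n ℂ => X.trace.re :=
    Complex.continuous_re.comp continuous_id.matrix_trace
  refine le_of_tendsto ((hcont.tendsto _).comp (hlim.comp hsub)) (Eventually.of_forall fun k => ?_)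
  have hk : 2 ^ k - 1 + 1 = 2 ^ k := Nat.sub_add_cancel Nat.one_le_two_pow
  have hk' : ((2 ^ k - 1 : ℕ) : ℝ) + 1 = 2 ^ k := by exact_mod_cast hk
  have hpow : ∀ C : Matrix n n ℂ, NormedSpace.exp (((2 : ℝ) ^ k)⁻¹ • C) ^ 2 ^ k
      = NormedSpace.exp C := fun C => by
    rw [← exp_nsmul, ← Nat.cast_smul_eq_nsmul ℝ, smul_smul]
    push_cast
    rw [mul_inv_cancel₀ (by positivity), one_smul]
  have hherm : ∀ C : Matrix n n ℂ, C.IsHermitian →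
      (NormedSpace.exp (((2 : ℝ) ^ k)⁻¹ • C)).IsHermitian := fun C hC =>
    IsHermitian.exp (hC.smul (by simp [IsSelfAdjoint]))
  have h := (re_trace_pow_two_pow_le k).2 _ _ (hherm A hA) (hherm B hB)
  rw [hpow, hpow] at h
  simp only [Function.comp_apply, hk, hk']
  exact h

end Matrix

end GoldenThompson

/-! ### Exponentials of Hermitian matrices through the spectral theorem. -/

section HermitianExp

open scoped ComplexOrder

namespace Matrix

theorem re_trace_mul_conjTranspose_self {m n : Type*} [Fintype m] [Fintype n]
    (X : Matrix m n ℂ) : (X * Xᴴ).trace.re = ∑ i, ∑ k, ‖X i k‖ ^ 2 := by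
  simp only [trace, diag_apply, mul_apply, conjTranspose_apply, Complex.re_sum, RCLike.star_def,
    Complex.mul_conj, Complex.normSq_eq_norm_sq, Complex.ofReal_re]

variable {n : Type*} [Fintype n]

theorem re_trace_mul_self_mul_nonneg {R M : Matrix n n ℂ} (hR : R.IsHermitian)
    (hM : M.PosSemidef) : 0 ≤ (R * R * M).trace.re := by
  have h := (hM.mul_mul_conjTranspose_same R).trace_nonneg
  rw [hR.eq, trace_mul_comm, ← mul_assoc] at h
  exact (Complex.le_def.1 h).1

theorem re_trace_mul_self_mul_mul_conjTranspose {m : Type*} [Fintype m] {R : Matrix n n ℂ}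
    (hR : R.IsHermitian) (M : Matrix n m ℂ) :
    (R * R * (M * Mᴴ)).trace.re = ∑ i, ∑ k, ‖∑ l, R i l * M l k‖ ^ 2 := by
  have : (R * R * (M * Mᴴ)).trace = ((R * M) * (R * M)ᴴ).trace := by
    rw [conjTranspose_mul, hR.eq, mul_assoc R R, trace_mul_comm R]
    simp only [Matrix.mul_assoc]
  rw [this, re_trace_mul_conjTranspose_self]
  simp only [mul_apply]

variable [DecidableEq n]

theorem IsHermitian.eq_mul_diagonal_mul {A : Matrix n n ℂ} (hA : A.IsHermitian) :
    A = (hA.eigenvectorUnitary : Matrix n n ℂ) *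
      diagonal (fun i => ((hA.eigenvalues i : ℝ) : ℂ)) *
        (hA.eigenvectorUnitary : Matrix n n ℂ)ᴴ := by
  conv_lhs => rw [hA.spectral_theorem]
  rw [Unitary.conjStarAlgAut_apply]
  rfl

theorem IsHermitian.exp_smul_eq {A : Matrix n n ℂ} (hA : A.IsHermitian) (s : ℝ) :
    NormedSpace.exp (s • A) = (hA.eigenvectorUnitary : Matrix n n ℂ) *
      diagonal (fun i => ((Real.exp (s * hA.eigenvalues i) : ℝ) : ℂ)) *
        (hA.eigenvectorUnitary : Matrix n n ℂ)ᴴ := by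
  set U := hA.eigenvectorUnitary
  have hU : (U : Matrix n n ℂ) * (U : Matrix n n ℂ)ᴴ = 1 := Unitary.coe_mul_star_self U
  have hinv : (U : Matrix n n ℂ)⁻¹ = (U : Matrix n n ℂ)ᴴ := inv_eq_right_inv hU
  have hunit : IsUnit (U : Matrix n n ℂ) := IsUnit.of_mul_eq_one _ hU
  have : s • A = (U : Matrix n n ℂ) * diagonal (fun i => ((s * hA.eigenvalues i : ℝ) : ℂ)) *
      (U : Matrix n n ℂ)⁻¹ := by
    conv_lhs => rw [hA.eq_mul_diagonal_mul]
    rw [hinv, ← smul_mul_assoc, ← mul_smul_comm]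
    congr 2
    ext i j
    by_cases h : i = j
    · subst h; simp
    · simp [h]
  rw [this, exp_conj _ _ hunit, exp_diagonal, hinv]
  congr 3
  ext i
  rw [Pi.coe_exp, ← Complex.exp_eq_exp_ℂ, Complex.ofReal_exp]

theorem IsHermitian.re_trace_exp_smul {A : Matrix n n ℂ} (hA : A.IsHermitian) (s : ℝ) :
    (NormedSpace.exp (s • A)).trace.re = ∑ i, Real.exp (s * hA.eigenvalues i) := by
  have hU : (hA.eigenvectorUnitary : Matrix n n ℂ)ᴴ * (hA.eigenvectorUnitary : Matrix n n ℂ) = 1 :=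
    Unitary.coe_star_mul_self _
  rw [hA.exp_smul_eq, trace_mul_comm, ← mul_assoc, hU, one_mul, trace_diagonal, Complex.re_sum]
  simp only [Complex.ofReal_re]

/-- On eigenvalues `0 ≤ x ≤ m` this is `exp(sx) ≤ 1 + s x exp(sx) ≤ 1 + s x exp(sm)`. Both steps
hold for either sign of `s`, so the same bound serves both tails. -/
theorem PosSemidef.one_add_smul_sub_exp {Z : Matrix n n ℂ} (hZ : Z.PosSemidef) {m : ℝ}
    (hm : ((m : ℂ) • (1 : Matrix n n ℂ) - Z).PosSemidef) (s : ℝ) :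
    (1 + ((s * Real.exp (s * m) : ℝ) : ℂ) • Z - NormedSpace.exp (s • Z)).PosSemidef := by
  set U : Matrix n n ℂ := (hZ.1.eigenvectorUnitary : Matrix n n ℂ) with hUdef
  have hU : U * Uᴴ = 1 := Unitary.coe_mul_star_self _
  have hle : ∀ i, hZ.1.eigenvalues i ≤ m := fun i => by
    have h := hm.re_dotProduct_nonneg (hZ.1.eigenvectorBasis i)
    rw [sub_mulVec, dotProduct_sub, map_sub, ← hZ.1.eigenvalues_eq, smul_mulVec, one_mulVec,
      dotProduct_smul, dotProduct_comm, ← EuclideanSpace.inner_eq_star_dotProduct] at h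
    simpa using h
  have key : 1 + ((s * Real.exp (s * m) : ℝ) : ℂ) • Z - NormedSpace.exp (s • Z)
      = U * diagonal (fun i => ((1 + s * Real.exp (s * m) * hZ.1.eigenvalues i
          - Real.exp (s * hZ.1.eigenvalues i) : ℝ) : ℂ)) * Uᴴ := by
    have e1 : Z = U * diagonal (fun i => ((hZ.1.eigenvalues i : ℝ) : ℂ)) * Uᴴ :=
      hZ.1.eq_mul_diagonal_mul
    have e2 := hZ.1.exp_smul_eq s
    rw [e2, ← hUdef]
    generalize hZ.1.eigenvalues = x at e1
    clear_value U
    rw [← hU, e1]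
    rw [← smul_mul_assoc, ← mul_smul_comm]
    nth_rewrite 1 [← mul_one U]
    rw [← add_mul, ← sub_mul, ← mul_add, ← mul_sub]
    congr 2
    ext i j
    by_cases h : i = j
    · subst h; simp
    · simp [h]
  rw [key]
  refine PosSemidef.mul_mul_conjTranspose_same (posSemidef_diagonal_iff.2 fun i => ?_) U
  rw [Complex.zero_le_real]
  set x := hZ.1.eigenvalues i
  have hx : 0 ≤ x := hZ.eigenvalues_nonneg i
  have h1 : Real.exp (s * x) ≤ 1 + s * x * Real.exp (s * x) := by
    have := Real.add_one_le_exp (-(s * x))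
    rw [Real.exp_neg] at this
    have hp := Real.exp_pos (s * x)
    have h2 := mul_le_mul_of_nonneg_right this hp.le
    rw [inv_mul_cancel₀ hp.ne'] at h2
    linarith
  have h2 : s * x * Real.exp (s * x) ≤ s * x * Real.exp (s * m) := by
    rcases le_total 0 s with hs | hs
    · exact mul_le_mul_of_nonneg_left (Real.exp_le_exp.2 (mul_le_mul_of_nonneg_left (hle i) hs))
        (mul_nonneg hs hx)
    · exact mul_le_mul_of_nonpos_left
        (Real.exp_le_exp.2 (mul_le_mul_of_nonpos_left (hle i) hs))
        (mul_nonpos_of_nonpos_of_nonneg hs hx)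
  linarith

theorem IsHermitian.exists_exp_eq_mul_self {S : Matrix n n ℂ} (hS : S.IsHermitian) :
    ∃ R : Matrix n n ℂ, R.IsHermitian ∧ NormedSpace.exp S = R * R := by
  refine ⟨NormedSpace.exp ((2 : ℝ)⁻¹ • S), IsHermitian.exp (hS.smul (by simp [IsSelfAdjoint])), ?_⟩
  rw [← exp_add_of_commute _ _ (Commute.refl _), ← add_smul]
  norm_num

end Matrix

end HermitianExp

/-! ### The matrix Laplace transform of an i.i.d. sum. -/

section MatrixLaplace

open scoped ENNReal

namespace Matrix

theorem continuous_re_trace_exp {n X : Type*} [Fintype n] [DecidableEq n] [TopologicalSpace X]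
    {f : X → Matrix n n ℂ} (hf : Continuous f) :
    Continuous fun x => (NormedSpace.exp (f x)).trace.re := by
  have hexp : Continuous (NormedSpace.exp : Matrix n n ℂ → Matrix n n ℂ) := by
    open scoped Norms.Operator in
    exact NormedSpace.exp_continuous
  exact Complex.continuous_re.comp (hexp.comp hf).matrix_trace

/-- Iterated Golden-Thompson bound for the matrix Laplace transform of a sum of independent
identically distributed random Hermitian matrices. -/
theorem lintegral_re_trace_exp_sum_le {n E : Type*} [Fintype n] [DecidableEq n]
    [TopologicalSpace E] [SecondCountableTopology E] [MeasurableSpace E] [BorelSpace E]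
    (γ : Measure E) [IsProbabilityMeasure γ] {Z : E → Matrix n n ℂ} (hZc : Continuous Z)
    (hZ : ∀ x, (Z x).IsHermitian) (ρ : ℝ≥0∞)
    (h : ∀ S : Matrix n n ℂ, S.IsHermitian →
      ∫⁻ x, ENNReal.ofReal (NormedSpace.exp S * NormedSpace.exp (Z x)).trace.re ∂γ ≤
        ρ * ENNReal.ofReal (NormedSpace.exp S).trace.re) (N : ℕ) :
    ∫⁻ x, ENNReal.ofReal (NormedSpace.exp (∑ i, Z (x i))).trace.re
      ∂(Measure.pi fun _ : Fin N => γ) ≤ ρ ^ N * Fintype.card n := by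
  induction N with
  | zero => simp
  | succ N ih =>
    have hmp := (measurePreserving_piFinSuccAbove (fun _ : Fin (N + 1) => γ) 0).symm
    have hcont : Continuous fun p : E × (Fin N → E) =>
        (NormedSpace.exp (Z p.1 + ∑ i, Z (p.2 i))).trace.re := by
      apply continuous_re_trace_exp
      fun_prop
    rw [← hmp.lintegral_comp_emb (MeasurableEquiv.measurableEmbedding _)]
    simp only [MeasurableEquiv.piFinSuccAbove_symm_apply, Fin.insertNthEquiv, Equiv.coe_fn_mk,
      Fin.sum_univ_succ, Fin.insertNth_zero, Fin.cons_zero, Fin.cons_succ, cast_eq]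
    -- The first sample is integrated innermost; the sum over the remaining samples is then fixed
    -- and plays the role of `S` in `h`.
    rw [lintegral_prod_symm' _ hcont.measurable.ennreal_ofReal]
    calc _ ≤ ∫⁻ y, ρ * ENNReal.ofReal (NormedSpace.exp (∑ i, Z (y i))).trace.re
          ∂(Measure.pi fun _ : Fin N => γ) := by
          refine lintegral_mono fun y => ?_
          have hS : (∑ i, Z (y i)).IsHermitian := by
            simp only [IsHermitian, conjTranspose_sum, (hZ _).eq]
          refine (lintegral_mono fun x => ?_).trans (h _ hS)
          refine ENNReal.ofReal_le_ofReal ?_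
          rw [add_comm]
          exact re_trace_exp_add_le hS (hZ x)
      _ = ρ * ∫⁻ y, ENNReal.ofReal (NormedSpace.exp (∑ i, Z (y i))).trace.re
          ∂(Measure.pi fun _ : Fin N => γ) := by
          refine lintegral_const_mul _ (Continuous.measurable ?_).ennreal_ofReal
          apply continuous_re_trace_exp
          fun_prop
      _ ≤ ρ * (ρ ^ N * Fintype.card n) := by gcongr
      _ = _ := by ring

end Matrix

end MatrixLaplace

/-! ### Exponentially tilted second moments. -/

section TiltedMoments

open Finset

/-- The norm on `ι → ℂ` is the sup norm, attained at some coordinate. This crude union bound is what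
makes the dimension enter. -/
theorem exp_norm_sq_le_sum {ι : Type*} [Fintype ι] [Nonempty ι] (c : ι → ℂ) {a : ℝ} :
    Real.exp (a * ‖c‖ ^ 2) ≤ ∑ l, Real.exp (a * ‖c l‖ ^ 2) := by
  obtain ⟨l, -, hl⟩ := exists_mem_eq_sup' (univ_nonempty (α := ι)) fun l => ‖c l‖₊
  have : ‖c‖ = ‖c l‖ := by
    rw [Pi.norm_def, ← sup'_eq_sup univ_nonempty, hl]; rfl
  rw [this]
  exact single_le_sum (f := fun l => Real.exp (a * ‖c l‖ ^ 2)) (fun _ _ => (Real.exp_pos _).le)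
    (mem_univ l)

theorem norm_sum_mul_sq_le {ι : Type*} [Fintype ι] (y c : ι → ℂ) :
    ‖∑ l, y l * c l‖ ^ 2 ≤ (∑ l, ‖y l‖ ^ 2) * (Fintype.card ι * ‖c‖ ^ 2) := by
  calc ‖∑ l, y l * c l‖ ^ 2 ≤ (∑ l, ‖y l‖ * ‖c l‖) ^ 2 := by
        gcongr
        exact (norm_sum_le _ _).trans_eq (by simp)
    _ ≤ (∑ l, ‖y l‖ ^ 2) * ∑ l, ‖c l‖ ^ 2 := sum_mul_sq_le_sq_mul_sq _ _ _
    _ ≤ _ := by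
        gcongr
        calc ∑ l, ‖c l‖ ^ 2 ≤ ∑ _l : ι, ‖c‖ ^ 2 := by
              gcongr with l; exact norm_le_pi_norm c l
          _ = _ := by simp

/-- Exponentially tilted second moments of linear forms in an isotropic random vector with
sub-Gaussian coordinates. -/
theorem integral_exp_norm_sq_mul_le {ι E : Type*} [Fintype ι] [Nonempty ι] [MeasurableSpace E]
    {γ : Measure E} [IsProbabilityMeasure γ] {c : E → ι → ℂ} (hc : Measurable c)
    (hi : ∀ l, Integrable (fun x => Real.exp (8⁻¹ * ‖c x l‖ ^ 2)) γ)
    (hle : ∀ l, ∫ x, Real.exp (8⁻¹ * ‖c x l‖ ^ 2) ∂γ ≤ 2) (y : ι → ℂ) :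
    Integrable (fun x => Real.exp (16⁻¹ * ‖c x‖ ^ 2) * ‖∑ l, y l * c x l‖ ^ 2) γ ∧
    ∫ x, Real.exp (16⁻¹ * ‖c x‖ ^ 2) * ‖∑ l, y l * c x l‖ ^ 2 ∂γ ≤
      32 * (Fintype.card ι : ℝ) ^ 2 * ∑ l, ‖y l‖ ^ 2 := by
  have hbd : ∀ x, Real.exp (16⁻¹ * ‖c x‖ ^ 2) * ‖∑ l, y l * c x l‖ ^ 2 ≤
      16 * Fintype.card ι * (∑ l, ‖y l‖ ^ 2) * ∑ l, Real.exp (8⁻¹ * ‖c x l‖ ^ 2) := fun x => by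
    -- The polynomial growth of the linear form is paid for with a second exponential weight: `1/16
    -- + 1/16 = 1/8`, the exponent that `hi` controls.
    have h1 : ‖c x‖ ^ 2 ≤ 16 * Real.exp (16⁻¹ * ‖c x‖ ^ 2) := by
      linarith [Real.add_one_le_exp (16⁻¹ * ‖c x‖ ^ 2)]
    have h2 : Real.exp (8⁻¹ * ‖c x‖ ^ 2) =
        Real.exp (16⁻¹ * ‖c x‖ ^ 2) * Real.exp (16⁻¹ * ‖c x‖ ^ 2) := by
      rw [← Real.exp_add]; congr 1; ring
    calc _ ≤ Real.exp (16⁻¹ * ‖c x‖ ^ 2) * ((∑ l, ‖y l‖ ^ 2) *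
          (Fintype.card ι * (16 * Real.exp (16⁻¹ * ‖c x‖ ^ 2)))) := by
          gcongr
          exact (norm_sum_mul_sq_le _ _).trans (by gcongr)
      _ = 16 * Fintype.card ι * (∑ l, ‖y l‖ ^ 2) * Real.exp (8⁻¹ * ‖c x‖ ^ 2) := by
          rw [h2]; ring
      _ ≤ _ := by
          gcongr
          exact exp_norm_sq_le_sum _
  have hint : Integrable (fun x => 16 * Fintype.card ι * (∑ l, ‖y l‖ ^ 2) *
      ∑ l, Real.exp (8⁻¹ * ‖c x l‖ ^ 2)) γ :=
    (integrable_finsetSum _ fun l _ => hi l).const_mul _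
  have hI : Integrable (fun x => Real.exp (16⁻¹ * ‖c x‖ ^ 2) * ‖∑ l, y l * c x l‖ ^ 2) γ := by
    refine hint.mono' (by fun_prop) (.of_forall fun x => ?_)
    rw [Real.norm_of_nonneg (by positivity)]
    exact hbd x
  refine ⟨hI, (integral_mono hI hint hbd).trans ?_⟩
  rw [integral_const_mul, integral_finsetSum _ fun l _ => hi l]
  calc _ ≤ 16 * Fintype.card ι * (∑ l, ‖y l‖ ^ 2) * ∑ _l : ι, (2 : ℝ) := by
        gcongr with l; exact hle l
    _ = _ := by simp; ring

/-- Weighted AM-GM for `1` and `exp t / A`. It interpolates between no tilt and full tilt, so that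
the cost drops from `A` to `A ^ p`. -/
theorem exp_mul_le_of_mem_Icc {A p t : ℝ} (hA : 0 < A) (hp0 : 0 ≤ p) (hp1 : p ≤ 1) :
    Real.exp (p * t) ≤ A ^ p * (1 - p + p * (Real.exp t / A)) := by
  have h := Real.geom_mean_le_arith_mean2_weighted (w₁ := 1 - p) (w₂ := p) (p₁ := 1)
    (p₂ := Real.exp t / A) (by linarith) hp0 zero_le_one (by positivity) (by ring)
  rw [Real.one_rpow, one_mul, mul_one, Real.div_rpow (Real.exp_pos _).le hA.le,
    ← Real.exp_mul, div_le_iff₀ (by positivity), mul_comm t] at h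
  linarith

/-- Expand `exp(-u) (1 - exp u / R)² ≥ 0`. It converts an upper bound `R` on an average of `exp u`
into the lower bound `2/R - R/R² = 1/R` on that of `exp(-u)`. -/
theorem two_div_sub_le_exp_neg {R u : ℝ} (hR : 0 < R) :
    2 / R - Real.exp u / R ^ 2 ≤ Real.exp (-u) := by
  rw [Real.exp_neg]
  have hu := Real.exp_pos u
  have h := mul_nonneg (inv_nonneg.2 hu.le) (sq_nonneg (1 - Real.exp u / R))
  have : (Real.exp u)⁻¹ * (1 - Real.exp u / R) ^ 2
      = (Real.exp u)⁻¹ - (2 / R - Real.exp u / R ^ 2) := by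
    field_simp
    ring
  linarith

theorem integral_exp_mul_norm_sq_bounds {ι E : Type*} [Fintype ι] [Nonempty ι] [MeasurableSpace E]
    {γ : Measure E} [IsProbabilityMeasure γ] {c : E → ι → ℂ} (hc : Measurable c)
    (hi : ∀ l, Integrable (fun x => Real.exp (8⁻¹ * ‖c x l‖ ^ 2)) γ)
    (hle : ∀ l, ∫ x, Real.exp (8⁻¹ * ‖c x l‖ ^ 2) ∂γ ≤ 2)
    (hiso : ∀ y : ι → ℂ, Integrable (fun x => ‖∑ l, y l * c x l‖ ^ 2) γ ∧
      ∫ x, ‖∑ l, y l * c x l‖ ^ 2 ∂γ = ∑ l, ‖y l‖ ^ 2)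
    {p : ℝ} (hp0 : 0 ≤ p) (hp1 : p ≤ 1) (y : ι → ℂ) :
    (Integrable (fun x => Real.exp (p / 16 * ‖c x‖ ^ 2) * ‖∑ l, y l * c x l‖ ^ 2) γ ∧
      ∫ x, Real.exp (p / 16 * ‖c x‖ ^ 2) * ‖∑ l, y l * c x l‖ ^ 2 ∂γ ≤
        (32 * (Fintype.card ι : ℝ) ^ 2) ^ p * ∑ l, ‖y l‖ ^ 2) ∧
    (Integrable (fun x => Real.exp (-(p / 16) * ‖c x‖ ^ 2) * ‖∑ l, y l * c x l‖ ^ 2) γ ∧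
      ((32 * (Fintype.card ι : ℝ) ^ 2) ^ p)⁻¹ * ∑ l, ‖y l‖ ^ 2 ≤
      ∫ x, Real.exp (-(p / 16) * ‖c x‖ ^ 2) * ‖∑ l, y l * c x l‖ ^ 2 ∂γ) := by
  set A : ℝ := 32 * (Fintype.card ι : ℝ) ^ 2 with hAdef
  have hA : 0 < A := by positivity
  set R : ℝ := A ^ p with hRdef
  have hR : 0 < R := by positivity
  obtain ⟨hI, hIle⟩ := integral_exp_norm_sq_mul_le hc hi hle y
  obtain ⟨hJ, hJeq⟩ := hiso y
  set q : E → ℝ := fun x => ‖∑ l, y l * c x l‖ ^ 2 with hq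
  have hq0 : ∀ x, 0 ≤ q x := fun x => by positivity
  have hint : Integrable (fun x => R * ((1 - p) * q x +
      p / A * (Real.exp (16⁻¹ * ‖c x‖ ^ 2) * q x))) γ :=
    ((hJ.const_mul _).add (hI.const_mul _)).const_mul _
  have hbd : ∀ x, Real.exp (p / 16 * ‖c x‖ ^ 2) * q x ≤ R * ((1 - p) * q x +
      p / A * (Real.exp (16⁻¹ * ‖c x‖ ^ 2) * q x)) := fun x => by
    have h := mul_le_mul_of_nonneg_right
      (exp_mul_le_of_mem_Icc (t := 16⁻¹ * ‖c x‖ ^ 2) hA hp0 hp1) (hq0 x)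
    calc _ = Real.exp (p * (16⁻¹ * ‖c x‖ ^ 2)) * q x := by congr 2; ring
      _ ≤ _ := h
      _ = _ := by ring
  have hU : Integrable (fun x => Real.exp (p / 16 * ‖c x‖ ^ 2) * q x) γ := by
    refine hint.mono' (by fun_prop) (.of_forall fun x => ?_)
    rw [Real.norm_of_nonneg (by have := hq0 x; positivity)]
    exact hbd x
  have hUle : ∫ x, Real.exp (p / 16 * ‖c x‖ ^ 2) * q x ∂γ ≤ R * ∑ l, ‖y l‖ ^ 2 := by
    refine (integral_mono hU hint hbd).trans ?_
    rw [integral_const_mul, integral_add (hJ.const_mul _) (hI.const_mul _), integral_const_mul,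
      integral_const_mul, hJeq]
    gcongr
    have h1 : p / A * ∫ x, Real.exp (16⁻¹ * ‖c x‖ ^ 2) * q x ∂γ ≤ p / A * (A * ∑ l, ‖y l‖ ^ 2) := by
      gcongr
    have h2 : p / A * (A * ∑ l, ‖y l‖ ^ 2) = p * ∑ l, ‖y l‖ ^ 2 := by field_simp
    linarith
  refine ⟨⟨hU, hUle⟩, ?_⟩
  have hL : Integrable (fun x => Real.exp (-(p / 16) * ‖c x‖ ^ 2) * q x) γ := by
    refine hJ.mono' (by fun_prop) (.of_forall fun x => ?_)
    rw [Real.norm_of_nonneg (by have := hq0 x; positivity)]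
    refine mul_le_of_le_one_left (hq0 x) (Real.exp_le_one_iff.2 ?_)
    rw [neg_mul]
    exact neg_nonpos.2 (by positivity)
  refine ⟨hL, ?_⟩
  have hint2 : Integrable (fun x => 2 / R * q x -
      (R ^ 2)⁻¹ * (Real.exp (p / 16 * ‖c x‖ ^ 2) * q x)) γ :=
    (hJ.const_mul _).sub (hU.const_mul _)
  refine le_trans ?_ (integral_mono hint2 hL fun x => ?_)
  · rw [integral_sub (hJ.const_mul _) (hU.const_mul _), integral_const_mul, integral_const_mul,
      hJeq]
    have h1 : (R ^ 2)⁻¹ * ∫ x, Real.exp (p / 16 * ‖c x‖ ^ 2) * q x ∂γ ≤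
        (R ^ 2)⁻¹ * (R * ∑ l, ‖y l‖ ^ 2) := by gcongr
    have h2 : (R ^ 2)⁻¹ * (R * ∑ l, ‖y l‖ ^ 2) = R⁻¹ * ∑ l, ‖y l‖ ^ 2 := by
      field_simp
    have h3 : 2 / R * ∑ l, ‖y l‖ ^ 2 = 2 * (R⁻¹ * ∑ l, ‖y l‖ ^ 2) := by
      field_simp
    linarith
  · have h := mul_le_mul_of_nonneg_right
      (two_div_sub_le_exp_neg (u := p / 16 * ‖c x‖ ^ 2) hR) (hq0 x)
    calc _ = (2 / R - Real.exp (p / 16 * ‖c x‖ ^ 2) / R ^ 2) * q x := by ring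
      _ ≤ _ := h
      _ = _ := by simp only [neg_mul, hq]

end TiltedMoments

/-! ### Linear forms in independent Gaussians. -/

section GaussianLinearForm

open Finset

/-- Against the density, the integrand becomes a multiple of `exp(-x²/4)`; the exact value is `√2`.
-/
theorem integrable_exp_sq_standardGaussian :
    Integrable (fun x : ℝ => Real.exp (4⁻¹ * x ^ 2)) (gaussianReal 0 1) ∧
      ∫ x, Real.exp (4⁻¹ * x ^ 2) ∂(gaussianReal 0 1) ≤ 2 := by
  have he : ∀ x : ℝ, gaussianPDFReal 0 1 x * Real.exp (4⁻¹ * x ^ 2)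
      = (√(2 * Real.pi))⁻¹ * Real.exp (-(4⁻¹ : ℝ) * x ^ 2) := fun x => by
    rw [gaussianPDFReal, mul_assoc, ← Real.exp_add]
    simp only [NNReal.coe_one, mul_one, sub_zero]
    congr 2
    ring
  constructor
  · rw [gaussianReal_of_var_ne_zero _ one_ne_zero, gaussianPDF_def,
      integrable_withDensity_iff_integrable_smul₀' (by fun_prop) (by simp)]
    simp only [ENNReal.toReal_ofReal (gaussianPDFReal_nonneg _ _ _), smul_eq_mul, he]
    exact (integrable_exp_neg_mul_sq (by norm_num)).const_mul _
  · rw [integral_gaussianReal_eq_integral_smul one_ne_zero]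
    simp only [smul_eq_mul, he]
    rw [integral_const_mul, integral_gaussian, ← Real.sqrt_inv, ← Real.sqrt_mul (by positivity)]
    rw [Real.sqrt_le_left (by norm_num)]
    field_simp
    norm_num

variable {ι : Type*} [Fintype ι]

theorem hasLaw_sum_mul_pi_gaussianReal (v : ℝ≥0) (a : ι → ℝ) :
    HasLaw (fun x : ι → ℝ => ∑ j, a j * x j) (gaussianReal 0 (∑ j, NNReal.mk (a j ^ 2) (sq_nonneg _) * v))
      (Measure.pi fun _ => gaussianReal 0 v) := by
  classical
  have hlaw : ∀ j, HasLaw (fun x : ι → ℝ => a j * x j)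
      (gaussianReal 0 (NNReal.mk (a j ^ 2) (sq_nonneg _) * v)) (Measure.pi fun _ => gaussianReal 0 v) :=
    fun j => by
      have h := gaussianReal_const_mul
        (measurePreserving_eval (fun _ : ι => gaussianReal 0 v) j).hasLaw (a j)
      simpa using h
  have hind : iIndepFun (fun j (x : ι → ℝ) => a j * x j) (Measure.pi fun _ => gaussianReal 0 v) :=
    iIndepFun_pi (X := fun j (t : ℝ) => a j * t) fun j => by fun_prop
  have key : ∀ s : Finset ι, HasLaw (fun x : ι → ℝ => ∑ j ∈ s, a j * x j)
      (gaussianReal 0 (∑ j ∈ s, NNReal.mk (a j ^ 2) (sq_nonneg _) * v))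
      (Measure.pi fun _ => gaussianReal 0 v) := by
    intro s
    induction s using Finset.induction_on with
    | empty =>
      simp only [sum_empty, gaussianReal_zero_var]
      exact ⟨by fun_prop, by simp [Measure.map_const]⟩
    | insert j s hj ih =>
      have h := IndepFun.hasLaw_fun_add (hlaw j) ih ?_
      · rw [gaussianReal_conv_gaussianReal, add_zero] at h
        simpa only [sum_insert hj] using h
      · have h2 := hind.indepFun_finsetSum_of_notMem (fun j => by fun_prop) hj
        convert h2.symm using 1
        ext x
        simp
  exact key univ

theorem integral_sum_mul_sq_pi_gaussianReal (v : ℝ≥0) (a : ι → ℝ) :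
    Integrable (fun x : ι → ℝ => (∑ j, a j * x j) ^ 2) (Measure.pi fun _ => gaussianReal 0 v) ∧
      ∫ x, (∑ j, a j * x j) ^ 2 ∂(Measure.pi fun _ : ι => gaussianReal 0 v) =
        v * ∑ j, a j ^ 2 := by
  have h := hasLaw_sum_mul_pi_gaussianReal v a
  set w : ℝ≥0 := ∑ j, NNReal.mk (a j ^ 2) (sq_nonneg _) * v with hw
  have hint : Integrable (fun t : ℝ => t ^ 2) (gaussianReal 0 w) :=
    (memLp_id_gaussianReal 2).integrable_sq
  have hw' : (w : ℝ) = v * ∑ j, a j ^ 2 := by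
    rw [hw, NNReal.coe_sum, mul_sum]
    exact sum_congr rfl fun j _ => by simp [mul_comm]
  constructor
  · rw [← h.map_eq] at hint
    exact hint.comp_aemeasurable h.aemeasurable
  · have h1 := h.integral_comp (f := fun t : ℝ => t ^ 2) (by fun_prop)
    have h2 := variance_fun_id_gaussianReal (μ := 0) (v := w)
    rw [variance_eq_sub (X := fun x => x) (memLp_id_gaussianReal 2),
      integral_id_gaussianReal] at h2
    rw [← hw', ← h2]
    simpa [Function.comp_def] using h1

theorem integral_exp_sum_mul_sq_pi_gaussianReal (v : ℝ≥0) (a : ι → ℝ)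
    (ha : v * ∑ j, a j ^ 2 ≤ 1) :
    Integrable (fun x : ι → ℝ => Real.exp (4⁻¹ * (∑ j, a j * x j) ^ 2))
      (Measure.pi fun _ => gaussianReal 0 v) ∧
      ∫ x, Real.exp (4⁻¹ * (∑ j, a j * x j) ^ 2) ∂(Measure.pi fun _ : ι => gaussianReal 0 v)
        ≤ 2 := by
  have h := hasLaw_sum_mul_pi_gaussianReal v a
  set w : ℝ≥0 := ∑ j, NNReal.mk (a j ^ 2) (sq_nonneg _) * v with hw
  have hw' : (w : ℝ) = v * ∑ j, a j ^ 2 := by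
    rw [hw, NNReal.coe_sum, mul_sum]
    exact sum_congr rfl fun j _ => by simp [mul_comm]
  have hmap : gaussianReal 0 w = (gaussianReal 0 1).map (fun t => √w * t) := by
    rw [gaussianReal_map_const_mul]
    congr 1
    · simp
    · ext; simp
  obtain ⟨hs1, hs2⟩ := integrable_exp_sq_standardGaussian
  have hle : ∀ t : ℝ, Real.exp (4⁻¹ * (√w * t) ^ 2) ≤ Real.exp (4⁻¹ * t ^ 2) := fun t => by
    refine Real.exp_le_exp.2 ?_
    rw [mul_pow, Real.sq_sqrt w.coe_nonneg]
    have : (w : ℝ) ≤ 1 := hw' ▸ ha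
    have := mul_le_of_le_one_left (sq_nonneg t) this
    linarith
  have hI : Integrable (fun t : ℝ => Real.exp (4⁻¹ * (√w * t) ^ 2)) (gaussianReal 0 1) :=
    hs1.mono' (by fun_prop) (.of_forall fun t => by
      rw [Real.norm_of_nonneg (Real.exp_pos _).le]; exact hle t)
  have hI2 : Integrable (fun t : ℝ => Real.exp (4⁻¹ * t ^ 2)) (gaussianReal 0 w) := by
    rw [hmap, integrable_map_measure (by fun_prop) (by fun_prop)]
    exact hI
  constructor
  · rw [← h.map_eq] at hI2
    exact hI2.comp_aemeasurable h.aemeasurable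
  · have h1 := h.integral_comp (f := fun t : ℝ => Real.exp (4⁻¹ * t ^ 2)) (by fun_prop)
    simp only [Function.comp_def] at h1
    rw [h1, hmap, integral_map (by fun_prop) (by fun_prop)]
    exact (integral_mono hI hs1 hle).trans hs2

theorem norm_sum_mul_ofReal_sq (w : ι → ℂ) (x : ι → ℝ) :
    ‖∑ j, w j * (x j : ℂ)‖ ^ 2 =
      (∑ j, (w j).re * x j) ^ 2 + (∑ j, (w j).im * x j) ^ 2 := by
  rw [← Complex.normSq_eq_norm_sq, Complex.normSq_apply, Complex.re_sum, Complex.im_sum]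
  simp [pow_two]

theorem sum_norm_sq_eq (w : ι → ℂ) :
    ∑ j, ‖w j‖ ^ 2 = ∑ j, (w j).re ^ 2 + ∑ j, (w j).im ^ 2 := by
  rw [← sum_add_distrib]
  exact sum_congr rfl fun j _ => by
    rw [← Complex.normSq_eq_norm_sq, Complex.normSq_apply]; ring

theorem integral_norm_sum_mul_sq_pi_gaussianReal (v : ℝ≥0) (w : ι → ℂ) :
    Integrable (fun x : ι → ℝ => ‖∑ j, w j * (x j : ℂ)‖ ^ 2)
      (Measure.pi fun _ => gaussianReal 0 v) ∧
      ∫ x, ‖∑ j, w j * (x j : ℂ)‖ ^ 2 ∂(Measure.pi fun _ : ι => gaussianReal 0 v) =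
        v * ∑ j, ‖w j‖ ^ 2 := by
  simp only [norm_sum_mul_ofReal_sq]
  obtain ⟨h1, h1'⟩ := integral_sum_mul_sq_pi_gaussianReal v fun j => (w j).re
  obtain ⟨h2, h2'⟩ := integral_sum_mul_sq_pi_gaussianReal v fun j => (w j).im
  refine ⟨h1.add h2, ?_⟩
  rw [integral_add h1 h2, h1', h2', sum_norm_sq_eq, mul_add]

/-- AM-GM gives `exp(X²/8) exp(Y²/8) ≤ (exp(X²/4) + exp(Y²/4)) / 2` for the real part `X` and
imaginary part `Y`, so no independence between them is needed. -/
theorem integral_exp_norm_sum_mul_sq_pi_gaussianReal (v : ℝ≥0) (w : ι → ℂ)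
    (hw : v * ∑ j, ‖w j‖ ^ 2 ≤ 1) :
    Integrable (fun x : ι → ℝ => Real.exp (8⁻¹ * ‖∑ j, w j * (x j : ℂ)‖ ^ 2))
      (Measure.pi fun _ => gaussianReal 0 v) ∧
      ∫ x, Real.exp (8⁻¹ * ‖∑ j, w j * (x j : ℂ)‖ ^ 2)
        ∂(Measure.pi fun _ : ι => gaussianReal 0 v) ≤ 2 := by
  rw [sum_norm_sq_eq, mul_add] at hw
  have p1 : 0 ≤ v * ∑ j, (w j).re ^ 2 := by positivity
  have p2 : 0 ≤ v * ∑ j, (w j).im ^ 2 := by positivity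
  obtain ⟨h1, h1'⟩ := integral_exp_sum_mul_sq_pi_gaussianReal v (fun j => (w j).re) (by linarith)
  obtain ⟨h2, h2'⟩ := integral_exp_sum_mul_sq_pi_gaussianReal v (fun j => (w j).im) (by linarith)
  have hbd : ∀ x : ι → ℝ, Real.exp (8⁻¹ * ‖∑ j, w j * (x j : ℂ)‖ ^ 2) ≤
      2⁻¹ * (Real.exp (4⁻¹ * (∑ j, (w j).re * x j) ^ 2) +
        Real.exp (4⁻¹ * (∑ j, (w j).im * x j) ^ 2)) := fun x => by
    rw [norm_sum_mul_ofReal_sq]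
    set X := ∑ j, (w j).re * x j
    set Y := ∑ j, (w j).im * x j
    have e1 : ∀ t : ℝ, Real.exp (4⁻¹ * t ^ 2) = Real.exp (8⁻¹ * t ^ 2) ^ 2 := fun t => by
      rw [← Real.exp_nat_mul]; congr 1; push_cast; ring
    rw [mul_add, Real.exp_add, e1, e1]
    nlinarith [sq_nonneg (Real.exp (8⁻¹ * X ^ 2) - Real.exp (8⁻¹ * Y ^ 2))]
  have hI := (h1.add h2).const_mul 2⁻¹
  have hI' : Integrable (fun x : ι → ℝ => Real.exp (8⁻¹ * ‖∑ j, w j * (x j : ℂ)‖ ^ 2))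
      (Measure.pi fun _ => gaussianReal 0 v) :=
    hI.mono' (Continuous.aestronglyMeasurable (by fun_prop)) (.of_forall fun x => by
      rw [Real.norm_of_nonneg (Real.exp_pos _).le]; exact hbd x)
  refine ⟨hI', (integral_mono hI' hI hbd).trans ?_⟩
  rw [integral_const_mul]
  simp only [Pi.add_apply]
  rw [integral_add h1 h2]
  linarith

end GaussianLinearForm

/-! ### The one-column estimate for `D H (D H)ᴴ`. -/

section ScaledGram

open scoped ComplexOrder

namespace Matrix

variable {n m : Type*} [Fintype n] [DecidableEq n] [Fintype m]

/-- With `D = diagonal c`, the difference is `diag(‖c‖² - |c_l|²) + D (1 - H Hᴴ) Dᴴ`. -/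
theorem posSemidef_norm_sq_smul_sub_scaledGram {H : Matrix n m ℂ}
    (hH : (1 - H * Hᴴ).PosSemidef) (c : n → ℂ) :
    (((‖c‖ ^ 2 : ℝ) : ℂ) • (1 : Matrix n n ℂ) -
      (diagonal c * H) * (diagonal c * H)ᴴ).PosSemidef := by
  have key : ((‖c‖ ^ 2 : ℝ) : ℂ) • (1 : Matrix n n ℂ) - (diagonal c * H) * (diagonal c * H)ᴴ
      = diagonal (fun l => ((‖c‖ ^ 2 - ‖c l‖ ^ 2 : ℝ) : ℂ)) +
        diagonal c * (1 - H * Hᴴ) * (diagonal c)ᴴ := by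
    have e : diagonal (fun l => ((‖c‖ ^ 2 - ‖c l‖ ^ 2 : ℝ) : ℂ)) =
        ((‖c‖ ^ 2 : ℝ) : ℂ) • (1 : Matrix n n ℂ) - diagonal c * (diagonal c)ᴴ := by
      ext i j
      by_cases h : i = j
      · subst h
        simp [Complex.mul_conj, Complex.normSq_eq_norm_sq]
      · simp [h]
    rw [e, conjTranspose_mul, mul_sub, sub_mul, mul_one]
    simp only [Matrix.mul_assoc]
    abel
  rw [key]
  refine PosSemidef.add (posSemidef_diagonal_iff.2 fun l => ?_) (hH.mul_mul_conjTranspose_same _)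
  rw [Complex.zero_le_real, sub_nonneg]
  gcongr
  exact norm_le_pi_norm c l

theorem re_trace_exp_mul_exp_scaledGram_le {H : Matrix n m ℂ}
    (hH : (1 - H * Hᴴ).PosSemidef) (c : n → ℂ) (s : ℝ) {R : Matrix n n ℂ} (hR : R.IsHermitian) :
    (R * R * NormedSpace.exp (s • ((diagonal c * H) * (diagonal c * H)ᴴ))).trace.re ≤
      (R * R).trace.re + s * ∑ i, ∑ k, Real.exp (s * ‖c‖ ^ 2) *
        ‖∑ l, R i l * H l k * c l‖ ^ 2 := by
  have h := re_trace_mul_self_mul_nonneg hR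
    ((posSemidef_self_mul_conjTranspose (diagonal c * H)).one_add_smul_sub_exp
      (posSemidef_norm_sq_smul_sub_scaledGram hH c) s)
  rw [mul_sub, mul_add, mul_one, mul_smul_comm, trace_sub, trace_add, trace_smul, Complex.sub_re,
    Complex.add_re, smul_eq_mul, Complex.re_ofReal_mul,
    re_trace_mul_self_mul_mul_conjTranspose hR] at h
  have e : ∀ i k, ∑ l, R i l * (diagonal c * H) l k = ∑ l, R i l * H l k * c l := fun i k =>
    Finset.sum_congr rfl fun l _ => by rw [diagonal_mul]; ring
  simp only [e] at h
  simp only [← Finset.mul_sum]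
  linarith

/-- Writing `exp S = R²` turns the trace into `Tr R²` plus `s` times a sum of tilted squares of
linear forms. Its mean is at most `(1 + η) Tr R² ≤ exp η · Tr R²`. Keeping `s` inside `hκ` lets `κ`
and `η` be negative, as the lower tail requires. -/
theorem lintegral_re_trace_exp_mul_exp_scaledGram_le {E : Type*} [MeasurableSpace E]
    {γ : Measure E} [IsProbabilityMeasure γ] {c : E → n → ℂ} {H : Matrix n m ℂ}
    (hH : (1 - H * Hᴴ).PosSemidef) {s κ η : ℝ}
    (hκ : ∀ y : n → ℂ,
      Integrable (fun x => Real.exp (s * ‖c x‖ ^ 2) * ‖∑ l, y l * c x l‖ ^ 2) γ ∧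
      s * ∫ x, Real.exp (s * ‖c x‖ ^ 2) * ‖∑ l, y l * c x l‖ ^ 2 ∂γ ≤ κ * ∑ l, ‖y l‖ ^ 2)
    (hη : ∀ l, κ * ∑ k, ‖H l k‖ ^ 2 ≤ η) {S : Matrix n n ℂ} (hS : S.IsHermitian) :
    ∫⁻ x, ENNReal.ofReal (NormedSpace.exp S * NormedSpace.exp
        (s • ((diagonal (c x) * H) * (diagonal (c x) * H)ᴴ))).trace.re ∂γ ≤
      ENNReal.ofReal (Real.exp η) * ENNReal.ofReal (NormedSpace.exp S).trace.re := by
  obtain ⟨R, hR, hSR⟩ := hS.exists_exp_eq_mul_self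
  rw [hSR]
  have htr : (R * R).trace.re = ∑ i, ∑ l, ‖R i l‖ ^ 2 := by
    rw [← re_trace_mul_conjTranspose_self, hR.eq]
  set g : E → ℝ := fun x => (R * R).trace.re + s * ∑ i, ∑ k, Real.exp (s * ‖c x‖ ^ 2) *
        ‖∑ l, R i l * H l k * c x l‖ ^ 2 with hg
  have hfg : ∀ x, (R * R * NormedSpace.exp
      (s • ((diagonal (c x) * H) * (diagonal (c x) * H)ᴴ))).trace.re ≤ g x := fun x =>
    re_trace_exp_mul_exp_scaledGram_le hH (c x) s hR
  -- For `s < 0` the sign of `g` is not visible; it follows because `g` dominates the trace of a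
  -- product of two positive semidefinite matrices.
  have hg0 : ∀ x, 0 ≤ g x := fun x => by
    have hZ : (s • ((diagonal (c x) * H) * (diagonal (c x) * H)ᴴ)).IsHermitian :=
      (isHermitian_mul_conjTranspose_self _).smul (by simp [IsSelfAdjoint])
    obtain ⟨R', hR', hZR⟩ := hZ.exists_exp_eq_mul_self
    refine le_trans ?_ (hfg x)
    rw [hZR]
    refine re_trace_mul_self_mul_nonneg hR ?_
    nth_rewrite 2 [← hR'.eq]
    exact posSemidef_self_mul_conjTranspose R'
  have hi : ∀ i, Integrable (fun x => ∑ k, Real.exp (s * ‖c x‖ ^ 2) *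
      ‖∑ l, R i l * H l k * c x l‖ ^ 2) γ := fun i =>
    integrable_finsetSum _ fun k _ => (hκ fun l => R i l * H l k).1
  have hgi : Integrable g γ :=
    (integrable_const _).add ((integrable_finsetSum _ fun i _ => hi i).const_mul _)
  have hgle : ∫ x, g x ∂γ ≤ Real.exp η * (R * R).trace.re := by
    rw [hg, integral_add (integrable_const _)
      ((integrable_finsetSum _ fun i _ => hi i).const_mul _), integral_const, integral_const_mul,
      integral_finsetSum _ fun i _ => hi i]
    simp only [integral_finsetSum _ fun k _ => (hκ fun l => R _ l * H l k).1]
    have h1 : s * ∑ i, ∑ k, ∫ x, Real.exp (s * ‖c x‖ ^ 2) *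
        ‖∑ l, R i l * H l k * c x l‖ ^ 2 ∂γ ≤ η * (R * R).trace.re := by
      rw [htr]
      simp only [Finset.mul_sum]
      refine Finset.sum_le_sum fun i _ => ?_
      calc _ ≤ ∑ k, κ * ∑ l, ‖R i l * H l k‖ ^ 2 :=
            Finset.sum_le_sum fun k _ => (hκ fun l => R i l * H l k).2
        _ = ∑ l, ‖R i l‖ ^ 2 * (κ * ∑ k, ‖H l k‖ ^ 2) := by
            simp only [Finset.mul_sum, norm_mul, mul_pow]
            rw [Finset.sum_comm]
            exact Finset.sum_congr rfl fun _ _ => Finset.sum_congr rfl fun _ _ => by ring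
        _ ≤ ∑ l, ‖R i l‖ ^ 2 * η := by
            gcongr with l
            exact hη l
        _ = _ := Finset.sum_congr rfl fun _ _ => mul_comm _ _
    have h2 : 0 ≤ (R * R).trace.re := by rw [htr]; positivity
    have h3 := mul_le_mul_of_nonneg_right (Real.add_one_le_exp η) h2
    simp only [probReal_univ, one_smul]
    linarith
  calc _ ≤ ∫⁻ x, ENNReal.ofReal (g x) ∂γ :=
        lintegral_mono fun x => ENNReal.ofReal_le_ofReal (hfg x)
    _ = ENNReal.ofReal (∫ x, g x ∂γ) :=
        (ofReal_integral_eq_lintegral_ofReal hgi (.of_forall hg0)).symm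
    _ ≤ ENNReal.ofReal (Real.exp η * (R * R).trace.re) := ENNReal.ofReal_le_ofReal hgle
    _ = _ := ENNReal.ofReal_mul (Real.exp_pos _).le

end Matrix

end ScaledGram

namespace BlindDeconv

open scoped ComplexOrder

/-! ### Unitarity of the DFT and the law of a transformed column. -/

section DFT

variable {L : ℕ}

theorem dftMatrix_mul_conjTranspose : dftMatrix L * (dftMatrix L)ᴴ = 1 := by
  ext w w'
  have hL : (L : ℂ) ≠ 0 := by
    have := w.pos
    exact_mod_cast this.ne'
  set z : ℂ := Complex.exp (2 * Real.pi * Complex.I * (((w' : ℕ) : ℂ) - (w : ℕ)) / L) with hz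
  have hterm : ∀ l : Fin L, dftMatrix L w l * (dftMatrix L)ᴴ l w' = (L : ℂ)⁻¹ * z ^ (l : ℕ) := by
    intro l
    rw [Matrix.conjTranspose_apply, dftMatrix, Matrix.of_apply, Matrix.of_apply, RCLike.star_def,
      map_mul, ← Complex.exp_conj, hz, ← Complex.exp_nat_mul, mul_mul_mul_comm, ← Complex.exp_add]
    congr 1
    · have : ((√(L : ℝ) : ℝ) : ℂ) * ((√(L : ℝ) : ℝ) : ℂ) = L := by
        rw [← Complex.ofReal_mul, Real.mul_self_sqrt (Nat.cast_nonneg L), Complex.ofReal_natCast]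
      simp [← mul_inv, this]
    · congr 1
      simp [Complex.conj_ofNat]
      ring
  rw [Matrix.mul_apply, Finset.sum_congr rfl fun l _ => hterm l, ← Finset.mul_sum,
    Fin.sum_univ_eq_sum_range fun l => z ^ l]
  by_cases h : w = w'
  · subst h
    simp [hz, hL]
  · have hz1 : z ≠ 1 := by
      rw [hz, Ne, Complex.exp_eq_one_iff]
      rintro ⟨k, hk⟩
      have h2 : (2 * Real.pi * Complex.I : ℂ) ≠ 0 := Complex.two_pi_I_ne_zero
      have h3 : (((w' : ℕ) : ℂ) - (w : ℕ)) = k * L := by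
        rw [mul_div_assoc, mul_comm, mul_left_inj' h2, div_eq_iff hL] at hk
        exact hk
      have h4 : ((w' : ℕ) : ℤ) - (w : ℕ) = k * L := by exact_mod_cast h3
      have h5 := w.isLt
      have h6 := w'.isLt
      have h7 : (L : ℤ) ∣ ((w' : ℕ) : ℤ) - (w : ℕ) := ⟨k, by rw [h4, mul_comm]⟩
      have h8 := Int.eq_zero_of_abs_lt_dvd h7 (by rw [abs_lt]; constructor <;> omega)
      exact h (Fin.ext (by omega))
    have hzL : z ^ L = 1 := by
      rw [hz, ← Complex.exp_nat_mul, Complex.exp_eq_one_iff]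
      refine ⟨((w' : ℕ) : ℤ) - (w : ℕ), ?_⟩
      push_cast
      field_simp
    rw [geom_sum_eq hz1, hzL, Matrix.one_apply_ne h]
    simp

theorem hat_conjTranspose_mul_hat {K : ℕ} {B : Matrix (Fin L) (Fin K) ℝ} (hB : Bᵀ * B = 1) :
    (hat B)ᴴ * hat B = 1 := by
  have h1 : (dftMatrix L)ᴴ * dftMatrix L = 1 := mul_eq_one_comm.1 dftMatrix_mul_conjTranspose
  have h2 : (B.map fun x : ℝ => (x : ℂ))ᴴ * B.map (fun x : ℝ => (x : ℂ)) = 1 := by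
    have : (B.map fun x : ℝ => (x : ℂ))ᴴ = Bᵀ.map (fun x : ℝ => (x : ℂ)) := by
      ext i j; simp
    rw [this]
    have h3 := congrArg (fun M => M.map Complex.ofRealHom) hB
    simp only [Matrix.map_mul] at h3
    rw [Matrix.map_one _ (map_zero _) (map_one _)] at h3
    exact h3
  rw [hat, Matrix.conjTranspose_mul, Matrix.mul_assoc, ← Matrix.mul_assoc (dftMatrix L)ᴴ, h1,
    Matrix.one_mul, h2]

/-- `B̂ B̂ᴴ` is an orthogonal projection, hence so is its complement, which therefore equals itself
times its adjoint. -/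
theorem posSemidef_one_sub_hat_mul_conjTranspose {K : ℕ} {B : Matrix (Fin L) (Fin K) ℝ}
    (hB : Bᵀ * B = 1) : (1 - hat B * (hat B)ᴴ).PosSemidef := by
  have h : (1 - hat B * (hat B)ᴴ) = (1 - hat B * (hat B)ᴴ) * (1 - hat B * (hat B)ᴴ)ᴴ := by
    have h1 : hat B * (hat B)ᴴ * (hat B * (hat B)ᴴ) = hat B * (hat B)ᴴ := by
      rw [Matrix.mul_assoc, ← Matrix.mul_assoc (hat B)ᴴ, hat_conjTranspose_mul_hat hB,
        Matrix.one_mul]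
    rw [Matrix.conjTranspose_sub, Matrix.conjTranspose_one, Matrix.conjTranspose_mul,
      Matrix.conjTranspose_conjTranspose, mul_sub, mul_one, sub_mul, one_mul, h1, sub_self, sub_zero]
  rw [h]
  exact Matrix.posSemidef_self_mul_conjTranspose _

/-- The unnormalized discrete Fourier transform of a real vector. -/
noncomputable def dftVec (x : Fin L → ℝ) : Fin L → ℂ :=
  fun l => ∑ j, (√(L : ℝ) : ℂ) * dftMatrix L l j * (x j : ℂ)

theorem continuous_dftVec : Continuous (dftVec : (Fin L → ℝ) → Fin L → ℂ) := by
  unfold dftVec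
  fun_prop

theorem cHat_eq_dftVec {N : ℕ} (C : Matrix (Fin L) (Fin N) ℝ) (l : Fin L) (i : Fin N) :
    cHat C l i = dftVec (fun j => C j i) l := by
  simp [cHat, hat, dftVec, Matrix.mul_apply, Finset.mul_sum, mul_assoc]

theorem sum_norm_sq_vecMul_dftMatrix (y : Fin L → ℂ) :
    ∑ j, ‖∑ l, y l * ((√(L : ℝ) : ℂ) * dftMatrix L l j)‖ ^ 2 = L * ∑ l, ‖y l‖ ^ 2 := by
  have h1 : ∀ j, ∑ l, y l * ((√(L : ℝ) : ℂ) * dftMatrix L l j) =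
      (√(L : ℝ) : ℂ) * (y ᵥ* dftMatrix L) j := fun j => by
    rw [Matrix.vecMul, dotProduct, Finset.mul_sum]
    exact Finset.sum_congr rfl fun _ _ => by ring
  have h2 : ∀ u : Fin L → ℂ, ((∑ j, ‖u j‖ ^ 2 : ℝ) : ℂ) = u ⬝ᵥ star u := fun u => by
    simp [dotProduct, Complex.mul_conj, Complex.normSq_eq_norm_sq]
  simp only [h1, norm_mul, mul_pow, Complex.norm_real, Real.norm_of_nonneg (Real.sqrt_nonneg _),
    Real.sq_sqrt (Nat.cast_nonneg L), ← Finset.mul_sum]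
  congr 1
  apply Complex.ofReal_injective
  rw [h2, h2, Matrix.star_vecMul, ← Matrix.dotProduct_mulVec, Matrix.mulVec_mulVec,
    dftMatrix_mul_conjTranspose, Matrix.one_mulVec]

/-- The factor `L` from the unnormalized transform cancels the variance `1/L`. The coordinates of
`dftVec x` need not be independent; isotropy suffices. -/
theorem dftVec_isotropic (hL : L ≠ 0) (y : Fin L → ℂ) :
    Integrable (fun x => ‖∑ l, y l * dftVec x l‖ ^ 2)
      (Measure.pi fun _ : Fin L => gaussianReal 0 (L : ℝ≥0)⁻¹) ∧
    ∫ x, ‖∑ l, y l * dftVec x l‖ ^ 2 ∂(Measure.pi fun _ : Fin L => gaussianReal 0 (L : ℝ≥0)⁻¹)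
      = ∑ l, ‖y l‖ ^ 2 := by
  have h := integral_norm_sum_mul_sq_pi_gaussianReal (L : ℝ≥0)⁻¹
    fun j => ∑ l, y l * ((√(L : ℝ) : ℂ) * dftMatrix L l j)
  rw [sum_norm_sq_vecMul_dftMatrix] at h
  have e : ∀ x : Fin L → ℝ, ∑ l, y l * dftVec x l =
      ∑ j, (∑ l, y l * ((√(L : ℝ) : ℂ) * dftMatrix L l j)) * (x j : ℂ) := fun x => by
    simp only [dftVec, Finset.mul_sum, Finset.sum_mul]
    rw [Finset.sum_comm]
    exact Finset.sum_congr rfl fun _ _ => Finset.sum_congr rfl fun _ _ => by ring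
  simp only [e]
  refine ⟨h.1, h.2.trans ?_⟩
  have : (L : ℝ) ≠ 0 := Nat.cast_ne_zero.2 hL
  push_cast
  rw [inv_mul_cancel_left₀ this]

theorem integral_exp_dftVec_le (hL : L ≠ 0) (l : Fin L) :
    Integrable (fun x => Real.exp (8⁻¹ * ‖dftVec x l‖ ^ 2))
      (Measure.pi fun _ : Fin L => gaussianReal 0 (L : ℝ≥0)⁻¹) ∧
    ∫ x, Real.exp (8⁻¹ * ‖dftVec x l‖ ^ 2)
      ∂(Measure.pi fun _ : Fin L => gaussianReal 0 (L : ℝ≥0)⁻¹) ≤ 2 := by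
  refine integral_exp_norm_sum_mul_sq_pi_gaussianReal _ _ ?_
  have h := sum_norm_sq_vecMul_dftMatrix (Pi.single l (1 : ℂ))
  have e : ∑ i : Fin L, ‖(Pi.single l (1 : ℂ) : Fin L → ℂ) i‖ ^ 2 = 1 := by
    rw [Finset.sum_eq_single l (fun i _ hi => by simp [hi]) (by simp)]
    simp
  simp only [Pi.single_apply, ite_mul, one_mul, zero_mul, Finset.sum_ite_eq', Finset.mem_univ,
    if_true] at h e
  rw [h, e]
  have : (L : ℝ) ≠ 0 := Nat.cast_ne_zero.2 hL
  push_cast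
  rw [mul_one, inv_mul_cancel₀ this]

end DFT

/-! ### The matrix of `𝒜𝒜*` as a sum over the columns of `C`. -/

section Gram

variable {L K N : ℕ}

/-- The contribution of one column of `C` to the matrix of `𝒜𝒜*`. -/
noncomputable def columnGram (B : Matrix (Fin L) (Fin K) ℝ) (x : Fin L → ℝ) :
    Matrix (Fin L) (Fin L) ℂ :=
  (Matrix.diagonal (dftVec x) * hat B) * (Matrix.diagonal (dftVec x) * hat B)ᴴ

/-- The matrix of `𝒜𝒜*`. -/
noncomputable def gram (B : Matrix (Fin L) (Fin K) ℝ) (x : Fin N → Fin L → ℝ) :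
    Matrix (Fin L) (Fin L) ℂ :=
  ∑ i, columnGram B (x i)

theorem columnGram_isHermitian (B : Matrix (Fin L) (Fin K) ℝ) (x : Fin L → ℝ) :
    (columnGram B x).IsHermitian :=
  Matrix.isHermitian_mul_conjTranspose_self _

theorem continuous_columnGram (B : Matrix (Fin L) (Fin K) ℝ) : Continuous (columnGram B) := by
  have h : Continuous fun x : Fin L → ℝ => Matrix.diagonal (dftVec x) * hat B :=
    (continuous_dftVec.matrix_diagonal).matrix_mul continuous_const
  exact h.matrix_mul h.matrix_conjTranspose

theorem gram_isHermitian (B : Matrix (Fin L) (Fin K) ℝ) (x : Fin N → Fin L → ℝ) :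
    (gram B x).IsHermitian := by
  simp only [gram, Matrix.IsHermitian, Matrix.conjTranspose_sum, (columnGram_isHermitian _ _).eq]

theorem measOp_eq_toEuclideanLin (B : Matrix (Fin L) (Fin K) ℝ) (C : Matrix (Fin L) (Fin N) ℝ) :
    measOp B C = Matrix.toEuclideanLin
      (Matrix.of fun l (p : Fin K × Fin N) => hat B l p.1 * cHat C l p.2) := by
  ext X l
  simp [measOp, measMatrix, bHat, Matrix.trace, Matrix.mul_apply, Matrix.toLpLin_apply,
    Matrix.mulVec, dotProduct, Fintype.sum_prod_type, Matrix.vecMulVec_apply]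
  rw [Finset.sum_comm]
  exact Finset.sum_congr rfl fun _ _ => Finset.sum_congr rfl fun _ _ => by ring

theorem measOpGram_eq_toEuclideanLin (B : Matrix (Fin L) (Fin K) ℝ)
    (C : Matrix (Fin L) (Fin N) ℝ) :
    measOpGram B C = Matrix.toEuclideanLin (gram B fun i l => C l i) := by
  rw [measOpGram, measOp_eq_toEuclideanLin, ← Matrix.toEuclideanLin_conjTranspose_eq_adjoint,
    ← Matrix.toLpLin_mul_same]
  congr 1
  ext l l'
  rw [Matrix.mul_apply]
  simp only [Fintype.sum_prod_type, Matrix.of_apply, Matrix.conjTranspose_apply,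
    gram, columnGram, Matrix.sum_apply, cHat_eq_dftVec]
  rw [Finset.sum_comm]
  refine Finset.sum_congr rfl fun i _ => ?_
  rw [Matrix.mul_apply]
  refine Finset.sum_congr rfl fun k _ => ?_
  simp only [Matrix.conjTranspose_apply, Matrix.diagonal_mul, star_mul']
  ring

theorem exists_eigenvalue_eq (B : Matrix (Fin L) (Fin K) ℝ) (C : Matrix (Fin L) (Fin N) ℝ) {z : ℂ}
    (hz : (measOpGram B C).HasEigenvalue z) :
    ∃ j, z = ((gram_isHermitian B fun i l => C l i).eigenvalues j : ℂ) := by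
  rw [measOpGram_eq_toEuclideanLin] at hz
  have h := hz.mem_spectrum
  rw [Matrix.spectrum_toLpLin,
    (gram_isHermitian B fun i l => C l i).spectrum_eq_image_range] at h
  obtain ⟨_, ⟨j, rfl⟩, h⟩ := h
  exact ⟨j, h.symm⟩

theorem norm_bHat_sq (B : Matrix (Fin L) (Fin K) ℝ) (l : Fin L) :
    ‖bHat B l‖ ^ 2 = ∑ k, ‖hat B l k‖ ^ 2 := by
  simp [bHat, EuclideanSpace.norm_sq_eq]

end Gram

end BlindDeconv

namespace BlindDeconv

/-! ### The joint law of the columns. -/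

section Law

variable {L N : ℕ}

/-- The joint law of the columns of `C`. -/
noncomputable def columnLaw (L N : ℕ) : Measure (Fin N → Fin L → ℝ) :=
  Measure.pi fun _ : Fin N => Measure.pi fun _ : Fin L => gaussianReal 0 (L : ℝ≥0)⁻¹

instance : IsProbabilityMeasure (columnLaw L N) := by
  unfold columnLaw; infer_instance

theorem hasLaw_columns {Ω : Type*} [MeasurableSpace Ω] {P : Measure Ω} [IsProbabilityMeasure P]
    {C : Ω → Matrix (Fin L) (Fin N) ℝ}
    (hC : ∀ l n, HasLaw (fun ω => C ω l n) (gaussianReal 0 ((L : ℝ≥0)⁻¹)) P)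
    (hind : iIndepFun (fun (p : Fin L × Fin N) (ω : Ω) => C ω p.1 p.2) P) :
    HasLaw (fun ω i l => C ω l i) (columnLaw L N) P := by
  have h1 := hind.precomp (Prod.swap_injective (α := Fin N) (β := Fin L))
  have h2 := iIndepFun.hasLaw_pi (fun p : Fin N × Fin L => hC p.2 p.1) h1
  have h3 := Measure.infinitePi_map_curry
    (fun (_ : Fin N) (_ : Fin L) => gaussianReal 0 ((L : ℝ≥0)⁻¹))
  simp only [Measure.infinitePi_eq_pi] at h3
  have h4 : HasLaw (MeasurableEquiv.curry (Fin N) (Fin L) ℝ) (columnLaw L N)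
      (Measure.pi fun _ : Fin N × Fin L => gaussianReal 0 ((L : ℝ≥0)⁻¹)) :=
    ⟨(MeasurableEquiv.curry (Fin N) (Fin L) ℝ).measurable.aemeasurable, h3⟩
  exact h4.fun_comp h2

end Law

/-! ### Chernoff bounds for the extreme eigenvalues. -/

section Tail

variable {L K : ℕ}

theorem measurable_re_trace_exp_gram (B : Matrix (Fin L) (Fin K) ℝ) (N : ℕ) (s : ℝ) :
    Measurable fun x : Fin N → Fin L → ℝ => (NormedSpace.exp (s • gram B x)).trace.re := by
  refine Continuous.measurable (Matrix.continuous_re_trace_exp ?_)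
  have := continuous_columnGram B
  unfold gram
  fun_prop

/-- Markov's inequality for the trace exponential: each column contributes `exp η`, and the factor
`L` is the trace of the identity. -/
theorem columnLaw_re_trace_exp_gram_ge_le {B : Matrix (Fin L) (Fin K) ℝ} (hB : Bᵀ * B = 1)
    {s κ η : ℝ}
    (hκ : ∀ y : Fin L → ℂ,
      Integrable (fun x => Real.exp (s * ‖dftVec x‖ ^ 2) * ‖∑ l, y l * dftVec x l‖ ^ 2)
        (Measure.pi fun _ : Fin L => gaussianReal 0 (L : ℝ≥0)⁻¹) ∧
      s * ∫ x, Real.exp (s * ‖dftVec x‖ ^ 2) * ‖∑ l, y l * dftVec x l‖ ^ 2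
        ∂(Measure.pi fun _ : Fin L => gaussianReal 0 (L : ℝ≥0)⁻¹) ≤ κ * ∑ l, ‖y l‖ ^ 2)
    (hη : ∀ l, κ * ‖bHat B l‖ ^ 2 ≤ η) (N : ℕ) (a : ℝ) :
    (columnLaw L N).real {x | Real.exp a ≤ (NormedSpace.exp (s • gram B x)).trace.re} ≤
      L * Real.exp (N * η - a) := by
  have hlap := Matrix.lintegral_re_trace_exp_sum_le
    (Measure.pi fun _ : Fin L => gaussianReal 0 (L : ℝ≥0)⁻¹)
    (Z := fun x => s • columnGram B x) ((continuous_columnGram B).const_smul s)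
    (fun x => (columnGram_isHermitian B x).smul (by simp [IsSelfAdjoint]))
    (ENNReal.ofReal (Real.exp η))
    (fun S hS => Matrix.lintegral_re_trace_exp_mul_exp_scaledGram_le
      (posSemidef_one_sub_hat_mul_conjTranspose hB) hκ
      (fun l => by rw [← norm_bHat_sq]; exact hη l) hS) N
  have hsum : ∀ x : Fin N → Fin L → ℝ, ∑ i, s • columnGram B (x i) = s • gram B x := fun x => by
    rw [gram, Finset.smul_sum]
  simp only [hsum, Fintype.card_fin] at hlap
  have hmarkov := meas_ge_le_lintegral_div (μ := columnLaw L N)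
    (measurable_re_trace_exp_gram B N s).ennreal_ofReal.aemeasurable
    (ENNReal.ofReal_pos.2 (Real.exp_pos a)).ne' ENNReal.ofReal_ne_top
  have hset : {x : Fin N → Fin L → ℝ | ENNReal.ofReal (Real.exp a) ≤
      ENNReal.ofReal (NormedSpace.exp (s • gram B x)).trace.re} =
      {x | Real.exp a ≤ (NormedSpace.exp (s • gram B x)).trace.re} := by
    ext x
    simp only [Set.mem_ofPred_eq]
    refine ⟨fun h => ?_, ENNReal.ofReal_le_ofReal⟩
    by_contra hlt
    exact absurd h (not_le.2 ((ENNReal.ofReal_lt_ofReal_iff (Real.exp_pos a)).2 (not_le.1 hlt)))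
  rw [hset] at hmarkov
  have h := hmarkov.trans (ENNReal.div_le_div_right hlap _)
  have he : ENNReal.ofReal (Real.exp η) ^ N * (L : ENNReal) / ENNReal.ofReal (Real.exp a) =
      ENNReal.ofReal (L * Real.exp (N * η - a)) := by
    rw [← ENNReal.ofReal_pow (Real.exp_pos _).le, ← Real.exp_nat_mul, ← ENNReal.ofReal_natCast,
      ← ENNReal.ofReal_mul (Real.exp_pos _).le, ← ENNReal.ofReal_div_of_pos (Real.exp_pos _),
      Real.exp_sub]
    congr 1
    ring
  rw [he] at h
  exact ENNReal.toReal_le_of_le_ofReal (by positivity) h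

theorem smul_eigenvalue_lt_of_re_trace_exp_lt {B : Matrix (Fin L) (Fin K) ℝ} {N : ℕ}
    {x : Fin N → Fin L → ℝ} {s a : ℝ}
    (h : (NormedSpace.exp (s • gram B x)).trace.re < Real.exp a) (j : Fin L) :
    s * (gram_isHermitian B x).eigenvalues j < a := by
  rw [(gram_isHermitian B x).re_trace_exp_smul] at h
  refine Real.exp_lt_exp.1 (lt_of_le_of_lt ?_ h)
  exact Finset.single_le_sum (f := fun i => Real.exp (s * (gram_isHermitian B x).eigenvalues i))
    (fun _ _ => (Real.exp_pos _).le) (Finset.mem_univ j)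

/-- Both tails of the spectrum of `𝒜𝒜*`, in terms of the extreme values of `‖b̂_l‖²`. -/
theorem one_sub_le_columnLaw_eigenvalues {B : Matrix (Fin L) (Fin K) ℝ} (hB : Bᵀ * B = 1)
    (hL : 2 ≤ L) {β βM : ℝ} (hβ0 : 0 ≤ β) (hβ : ∀ l, β ≤ ‖bHat B l‖ ^ 2)
    (hβM : ∀ l, ‖bHat B l‖ ^ 2 ≤ βM) {α : ℝ} {N : ℕ}
    (hN : 4000 * α * Real.log L ^ 2 ≤ N * β) :
    ∃ S : Set (Fin N → Fin L → ℝ), MeasurableSet S ∧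
      1 - 2 * (L : ℝ) ^ (-α + 1) ≤ (columnLaw L N).real S ∧
      ∀ x ∈ S, ∀ j, 0.48 * (N * β) ≤ (gram_isHermitian B x).eigenvalues j ∧
        (gram_isHermitian B x).eigenvalues j ≤ 4.5 * (N * βM) := by
  have hL0 : L ≠ 0 := by omega
  have hLpos : (0 : ℝ) < L := by exact_mod_cast Nat.pos_of_ne_zero hL0
  have : Nonempty (Fin L) := ⟨⟨0, by omega⟩⟩
  have hL2 : (2 : ℝ) ≤ L := by exact_mod_cast hL
  have hlog2 : Real.log 2 ≤ Real.log L := Real.log_le_log (by norm_num) hL2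
  have hlog2' := Real.log_two_gt_d9
  have hββM : β ≤ βM := (hβ (Classical.arbitrary _)).trans (hβM _)
  set t := Real.log L with ht
  have ht0 : 0 < t := by linarith
  -- For `L ≥ 2`, `32 L² ≤ L⁷`, so this `p` gives `(32 L²)^p ≤ exp(7/28) = exp(1/4) ≤ 1.3`.
  set p : ℝ := 1 / (28 * t) with hp
  have hp0 : 0 < p := by positivity
  have hp1 : p ≤ 1 := by
    rw [hp, div_le_one (by positivity)]; linarith
  have hpt : p * t = 1 / 28 := by rw [hp]; field_simp
  set R : ℝ := (32 * (L : ℝ) ^ 2) ^ p with hR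
  have hR0 : 0 < R := by positivity
  have hRle : R ≤ 1.3 := by
    have h1 : R = Real.exp ((5 * Real.log 2 + 2 * t) * p) := by
      rw [hR, Real.rpow_def_of_pos (by positivity), Real.log_mul (by norm_num) (by positivity),
        Real.log_pow, show (32 : ℝ) = 2 ^ 5 by norm_num, Real.log_pow,
        ← ht]
      norm_num
    have h2 : (5 * Real.log 2 + 2 * t) * p ≤ 1 / 4 := by
      have : (5 * Real.log 2 + 2 * t) * p ≤ (7 * t) * p := by gcongr; linarith
      linarith
    rw [h1]
    refine (Real.exp_le_exp.2 h2).trans ?_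
    have h3 : Real.exp (1 / 4) ^ 4 ≤ 1.3 ^ 4 := by
      rw [← Real.exp_nat_mul]
      norm_num
      linarith [Real.exp_one_lt_d9]
    exact le_of_pow_le_pow_left₀ (by norm_num) (by norm_num) h3
  have hRinv : 0.6 ≤ R⁻¹ := by
    rw [le_inv_comm₀ (by norm_num) hR0]
    exact hRle.trans (by norm_num)
  have hmom := integral_exp_mul_norm_sq_bounds
    (γ := Measure.pi fun _ : Fin L => gaussianReal 0 (L : ℝ≥0)⁻¹) (c := dftVec)
    continuous_dftVec.measurable (fun l => (integral_exp_dftVec_le hL0 l).1)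
    (fun l => (integral_exp_dftVec_le hL0 l).2) (dftVec_isotropic hL0) hp0.le hp1
  rw [Fintype.card_fin, ← hR] at hmom
  set θ : ℝ := p / 16 with hθ
  have hθ0 : 0 < θ := by positivity
  -- Here `θ = 1/(448 t)` and `0.12 = 0.6 - 0.48` is the margin of the lower tail; `4000 · 0.12 /
  -- 448 > 1` explains the constant `4000`. The upper tail has the larger margin `4.5 - 1.3`.
  have hmain : α * t ≤ 0.12 * (θ * (N * β)) := by
    have h1 : θ * (4000 * α * t ^ 2) ≤ θ * (N * β) := by gcongr
    have h2 : θ * (4000 * α * t ^ 2) = 250 / 28 * (α * t) := by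
      have : θ * (4000 * α * t ^ 2) = 250 * (p * t) * (α * t) := by rw [hθ]; ring
      rw [this, hpt]; ring
    have h3 : 0 ≤ θ * (N * β) := by positivity
    linarith
  have hrpow : (L : ℝ) * Real.exp (-(α * t)) = (L : ℝ) ^ (-α + 1) := by
    rw [Real.rpow_add hLpos, Real.rpow_one, Real.rpow_def_of_pos hLpos, ← ht, mul_comm]
    congr 2
    ring
  have hθβ : 0 ≤ θ * (N * β) := by positivity
  have hθM : θ * (N * β) ≤ θ * (N * βM) := by gcongr
  have hupper := columnLaw_re_trace_exp_gram_ge_le hB (s := θ) (κ := θ * R) (η := θ * R * βM)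
    (fun y => ⟨(hmom y).1.1, by
      rw [mul_assoc]; exact mul_le_mul_of_nonneg_left (hmom y).1.2 hθ0.le⟩)
    (fun l => mul_le_mul_of_nonneg_left (hβM l) (by positivity)) N (θ * (4.5 * (N * βM)))
  -- A negative `s` turns the lower bound on the tilted moments into the required upper bound, with
  -- negative `κ` and `η`.
  have hlower := columnLaw_re_trace_exp_gram_ge_le hB (s := -θ) (κ := -θ * R⁻¹)
    (η := -θ * R⁻¹ * β)
    (fun y => ⟨(hmom y).2.1, by
      rw [mul_assoc]; exact mul_le_mul_of_nonpos_left (hmom y).2.2 (neg_nonpos.2 hθ0.le)⟩)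
    (fun l => mul_le_mul_of_nonpos_left (hβ l)
      (mul_nonpos_of_nonpos_of_nonneg (neg_nonpos.2 hθ0.le) (by positivity)))
    N (-θ * (0.48 * (N * β)))
  have hupper' := hupper.trans (b := _) (c := (L : ℝ) ^ (-α + 1)) (by
    rw [← hrpow]
    gcongr
    have h1 := mul_le_mul_of_nonneg_left hRle (hθβ.trans hθM)
    linarith)
  have hlower' := hlower.trans (b := _) (c := (L : ℝ) ^ (-α + 1)) (by
    rw [← hrpow]
    gcongr
    have h1 := mul_le_mul_of_nonneg_left hRinv hθβ
    linarith)
  set T₁ : Set (Fin N → Fin L → ℝ) :=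
    {x | Real.exp (θ * (4.5 * (N * βM))) ≤ (NormedSpace.exp (θ • gram B x)).trace.re} with hT₁
  set T₂ : Set (Fin N → Fin L → ℝ) :=
    {x | Real.exp (-θ * (0.48 * (N * β))) ≤ (NormedSpace.exp (-θ • gram B x)).trace.re} with hT₂
  have hm : MeasurableSet (T₁ ∪ T₂) :=
    (measurableSet_le measurable_const (measurable_re_trace_exp_gram B N θ)).union
      (measurableSet_le measurable_const (measurable_re_trace_exp_gram B N (-θ)))
  refine ⟨(T₁ ∪ T₂)ᶜ, hm.compl, ?_, fun x hx j => ?_⟩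
  · rw [probReal_compl_eq_one_sub hm]
    have := measureReal_union_le (μ := columnLaw L N) T₁ T₂
    linarith
  · simp only [hT₁, hT₂, Set.mem_compl_iff, Set.mem_union, Set.mem_ofPred_eq, not_or, not_le] at hx
    have h1 := smul_eigenvalue_lt_of_re_trace_exp_lt hx.1 j
    have h2 := smul_eigenvalue_lt_of_re_trace_exp_lt hx.2 j
    rw [neg_mul, neg_mul, neg_lt_neg_iff] at h2
    exact ⟨(lt_of_mul_lt_mul_left h2 hθ0.le).le, (lt_of_mul_lt_mul_left h1 hθ0.le).le⟩

end Tail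

end BlindDeconv

/-! ### Conclusion. -/

theorem mainTheorem3 :
    ∃ c : ℝ, 0 < c ∧ ∀ α : ℝ, 1 ≤ α → ∃ Cα : ℝ, 1 < Cα ∧
      ∀ (L K N : ℕ) (B : Matrix (Fin L) (Fin K) ℝ), Bᵀ * B = 1 →
        0 < BlindDeconv.muMinSq B →
        Cα / BlindDeconv.muMinSq B * ((L : ℝ) * Real.log (L : ℝ) ^ 2) ≤ (N : ℝ) * (K : ℝ) →
        ∀ (Ω : Type*) [MeasurableSpace Ω] (P : Measure Ω) [IsProbabilityMeasure P]
          (C : Ω → Matrix (Fin L) (Fin N) ℝ),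
          (∀ l n, HasLaw (fun ω => C ω l n) (gaussianReal 0 ((L : ℝ≥0)⁻¹)) P) →
          iIndepFun (fun (p : Fin L × Fin N) (ω : Ω) => C ω p.1 p.2) P →
          1 - c * (L : ℝ) ^ (-α + 1) <
            P.real {ω | ∀ z : ℂ, (BlindDeconv.measOpGram B (C ω)).HasEigenvalue z →
              ∃ t : ℝ, z = (t : ℂ) ∧
                0.48 * BlindDeconv.muMinSq B * ((N : ℝ) * (K : ℝ) / (L : ℝ)) ≤ t ∧
                t ≤ 4.5 * BlindDeconv.muMaxSq B * ((N : ℝ) * (K : ℝ) / (L : ℝ))} := by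
  -- The two tails cost `2 L^(-α+1)`; the constant `3` makes the inequality strict.
  refine ⟨3, by norm_num, fun α hα => ⟨4000 * α, by linarith, ?_⟩⟩
  intro L K N B hB hμ hNK Ω _ P _ C hC hind
  -- If `L` or `K` vanishes, the prefactor `L / K` is `0` by convention, against `hμ`.
  have hL0 : L ≠ 0 := by
    rintro rfl
    simp [BlindDeconv.muMinSq] at hμ
  have hK0 : K ≠ 0 := by
    rintro rfl
    simp [BlindDeconv.muMinSq] at hμ
  have hLpos : (0 : ℝ) < L := by exact_mod_cast Nat.pos_of_ne_zero hL0
  have hKpos : (0 : ℝ) < K := by exact_mod_cast Nat.pos_of_ne_zero hK0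
  -- For `L = 1` the logarithm vanishes and `hNK` carries no information, but the claimed lower
  -- bound is `1 - 3 < 0`.
  rcases Nat.lt_or_ge L 2 with hL | hL
  · obtain rfl : L = 1 := by omega
    refine lt_of_lt_of_le ?_ measureReal_nonneg
    norm_num
  set β : ℝ := ⨅ l : Fin L, ‖BlindDeconv.bHat B l‖ ^ 2 with hβ
  set βM : ℝ := ⨆ l : Fin L, ‖BlindDeconv.bHat B l‖ ^ 2 with hβM
  have hμβ : BlindDeconv.muMinSq B = L / K * β := rfl
  have hμβM : BlindDeconv.muMaxSq B = L / K * βM := rfl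
  have hN : 4000 * α * Real.log L ^ 2 ≤ N * β := by
    rw [div_mul_eq_mul_div, div_le_iff₀ hμ, hμβ] at hNK
    have e : (N : ℝ) * K * (L / K * β) = N * β * L := by field_simp
    rw [e] at hNK
    refine le_of_mul_le_mul_right ?_ hLpos
    linarith
  obtain ⟨S, hS, hPS, hSe⟩ := BlindDeconv.one_sub_le_columnLaw_eigenvalues hB hL
    (β := β) (βM := βM) (Real.iInf_nonneg fun l => sq_nonneg _)
    (fun l => ciInf_le (Set.finite_range _).bddBelow l)
    (fun l => le_ciSup (f := fun l => ‖BlindDeconv.bHat B l‖ ^ 2) (Set.finite_range _).bddAbove l)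
    hN
  have hlaw := BlindDeconv.hasLaw_columns hC hind
  have hPS' := hlaw.measureReal_eq (p := fun x => x ∈ S) hS
  have hpos : (0 : ℝ) < (L : ℝ) ^ (-α + 1) := by positivity
  calc 1 - 3 * (L : ℝ) ^ (-α + 1) < 1 - 2 * (L : ℝ) ^ (-α + 1) := by linarith
    _ ≤ (BlindDeconv.columnLaw L N).real S := hPS
    _ = P.real {ω | (fun i l => C ω l i) ∈ S} := hPS'.symm
    _ ≤ _ := by
      refine measureReal_mono (Set.ofPred_subset_ofPred.2 fun ω hω z hz => ?_)
      obtain ⟨j, rfl⟩ := BlindDeconv.exists_eigenvalue_eq B (C ω) hz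
      obtain ⟨h1, h2⟩ := hSe _ hω j
      refine ⟨_, rfl, ?_, ?_⟩
      · refine le_trans (le_of_eq ?_) h1
        rw [hμβ]
        field_simp
      · refine h2.trans (le_of_eq ?_)
        rw [hμβM]
        field_simp
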